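/- Let $s\ge 2$ be an integer. The compact $(s,1)$-staircase surface $X$ is the rectangle $[0,s]\times[0,1]$ with the side identifications $(0,y)\sim(s,y)$ for $y\in[0,1]$, $(x,0)\sim(x+s-1,1)$ and $(x,1)\sim(x+s-1,0)$ for $x\in[0,1]$, and $(x,0)\sim(x,1)$ for $x\in[1,s-1]$. Let $\Sigma\subset X$ be the finite set of images of the points $(k,0),(k,1)$, $k=0,\dots,s$, and let $\eta_k$ be the relative homology class of the edge $[k-1,k]\times\{1\}$, oriented from left to right. Let $p:X_\Gamma\to X\setminus\Sigma$ be the $\mathbb Z$-cover associated to $\gamma=\eta_s-\eta_1$, that is, to the homomorphism $\zeta=\langle\gamma,\cdot\rangle:H_1(X\setminus\Sigma,\mathbb Z)\to\mathbb Z$ given by the intersection number with $\gamma$, and let $\Delta_n$ $(n\in\mathbb Z)$ be its deck transformations. A linear automorphism is a homeomorphism (of $X$, preserving $\Sigma$, or of $X_\Gamma$) that is affine with constant derivative in the translation charts; it is called linear pseudo-Anosov if its derivative $A$ is hyperbolic ($\det A=1$, $|\operatorname{tr}A|>2$), and an automorphism of $X_\Gamma$ is called homogeneous if it commutes with all $\Delta_n$.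 A $\mathbb Z$-coordinate is a measurable function $\xi:X_\Gamma\to\mathbb Z$ with $\xi\circ\Delta_n=\xi+n$ whose fundamental domain $\{\xi=0\}$ is bounded, in the sense that it meets only finitely many of the copies of the rectangle that make up $X_\Gamma$. The average drift of a homogeneous automorphism $\Psi$ of $X_\Gamma$ that is a lift of an automorphism of $X$ is $\int_X F\,dm$, where $F(p(y))=\xi(\Psi(y))-\xi(y)$ and $m$ is the normalized Lebesgue measure on $X$. Then there is a linear pseudo-Anosov automorphism $\psi$ of $X$ with a lift $\Psi$ to $X_\Gamma$ that is a homogeneous linear pseudo-Anosov automorphism of $X_\Gamma$ with zero average drift, for every $\mathbb Z$-coordinate. Moreover, $\psi$ and $\Psi$ can be chosen with the following properties. 1. $\psi=\tau_h\circ\tau_v$ and $\Psi=T_h\circ T_v$, where $\tau_h$ is a horizontal Dehn twist of $X$ with derivative $\begin{pmatrix}1&s\\0&1\end{pmatrix}$ that fixes the images of the horizontal sides pointwise, $\tau_v$ is a vertical Dehn (multi-)twist with derivative $\begin{pmatrix}1&0\\2&1\end{pmatrix}$ (acting on column vectors) that fixes the images of the segments $\{k\}\times[0,1]$, $0\le k\le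 s$, pointwise, both preserve the cover class ($\zeta\circ(\tau_h)_*=\zeta=\zeta\circ(\tau_v)_*$), and $T_h,T_v$ are homogeneous lifts of $\tau_h,\tau_v$ with zero average drift. 2. There is an involution $\iota$ of $X$ which is a linear automorphism with derivative $-\mathrm{Id}$, commutes with $\tau_h$ and $\tau_v$, and reverses the cover class ($\zeta\circ\iota_*=-\zeta$). It lifts to an involution $J$ of $X_\Gamma$ that commutes with $T_h$ and $T_v$ and satisfies $J\circ\Delta_n=\Delta_{-n}\circ J$ for all $n$. -/

import Mathlib

open MeasureTheory Filter Topology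
open scoped ENNReal

noncomputable section

namespace Staircase

/-! ### The compact surface -/

/-- The closed rectangle `[0, s] × [0, 1]`. -/
def Rect (s : ℕ) : Set (ℝ × ℝ) := Set.Icc (0 : ℝ) s ×ˢ Set.Icc (0 : ℝ) 1

/-- The permutation of the unit intervals `[k, k + 1]`, `k = 0, …, s - 1`: it exchanges the first
and the last interval and fixes the others. -/
def perm (s : ℕ) : Equiv.Perm ℕ := Equiv.swap 0 (s - 1)

/-- The side identifications: `(0, y) ∼ (s, y)`, and the `k`-th unit interval of the top side is
glued by a translation to the `perm s k`-th unit interval of the bottom side. -/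
def Glue (s : ℕ) (a b : Rect s) : Prop :=
  (a.1.1 = 0 ∧ b.1.1 = s ∧ a.1.2 = b.1.2) ∨
  ∃ k : ℕ, k < s ∧ ∃ t ∈ Set.Icc (0 : ℝ) 1, a.1 = ((k : ℝ) + t, 1) ∧ b.1 = ((perm s k : ℝ) + t, 0)

/-- The compact `(s, 1)`-staircase surface `X` (with the quotient topology and the quotient
`σ`-algebra). -/
def Surface (s : ℕ) : Type := Quot (Glue s)

instance (s : ℕ) : TopologicalSpace (Surface s) := inferInstanceAs (TopologicalSpace (Quot (Glue s)))
instance (s : ℕ) : MeasurableSpace (Surface s) := inferInstanceAs (MeasurableSpace (Quot (Glue s)))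

/-- The point of `X` represented by a point of the rectangle. -/
def Surface.mk {s : ℕ} (a : Rect s) : Surface s := Quot.mk (Glue s) a

/-- The end points of the unit intervals on the top and the bottom side. -/
def IsVertex (z : ℝ × ℝ) : Prop := (∃ k : ℕ, z.1 = k) ∧ (z.2 = 0 ∨ z.2 = 1)

/-- The finite set `Σ ⊂ X` of singularities and marked points. -/
def marked (s : ℕ) : Set (Surface s) := {x | ∃ a : Rect s, IsVertex a.1 ∧ Surface.mk a = x}

/-- The normalized Lebesgue measure on `X`. -/
def lebesgue (s : ℕ) : Measure (Surface s) :=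
  (s : ℝ≥0∞)⁻¹ • Measure.map Surface.mk
    (Measure.comap ((↑) : Rect s → ℝ × ℝ) (volume : Measure (ℝ × ℝ)))

/-! ### The `ℤ`-cover

The edge `η k` is the `k`-th unit interval of the top side, oriented from left to right. A relative
class `γ = ∑ c k • η k` determines a homomorphism `⟨γ, ·⟩ : H₁(X \ Σ; ℤ) → ℤ`: each upward crossing
of `η k` by a loop contributes `c k`, each downward crossing `- c k`. The associated `ℤ`-cover of
`X \ Σ` consists of `ℤ` copies of the rectangle without its vertices, where crossing `η k` upward
from the copy with number `n` leads to the copy with number `n + c k`. -/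

/-- The coefficients on the edges `η k` of the class `η (s - 1) - η 0` (last minus first edge). -/
def coverClass (s : ℕ) (k : ℕ) : ℤ := (if k = s - 1 then 1 else 0) - (if k = 0 then 1 else 0)

/-- The rectangle without the vertices. -/
def PRect (s : ℕ) : Set (ℝ × ℝ) := {z | z ∈ Rect s ∧ ¬ IsVertex z}

/-- The side identifications of the copies of the rectangle, for a class with coefficients `c`. -/
def CoverGlue (s : ℕ) (c : ℕ → ℤ) (a b : ℤ × PRect s) : Prop :=
  (a.2.1.1 = 0 ∧ b.2.1.1 = s ∧ a.2.1.2 = b.2.1.2 ∧ b.1 = a.1) ∨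
  ∃ k : ℕ, k < s ∧ ∃ t ∈ Set.Ioo (0 : ℝ) 1,
    a.2.1 = ((k : ℝ) + t, 1) ∧ b.2.1 = ((perm s k : ℝ) + t, 0) ∧ b.1 = a.1 + c k

/-- The `ℤ`-cover `X_Γ` associated to the class `η (s - 1) - η 0`; it is a cover of `X \ Σ`. -/
def Cover (s : ℕ) : Type := Quot (CoverGlue s (coverClass s))

instance (s : ℕ) : TopologicalSpace (Cover s) :=
  inferInstanceAs (TopologicalSpace (Quot (CoverGlue s (coverClass s))))
instance (s : ℕ) : MeasurableSpace (Cover s) :=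
  inferInstanceAs (MeasurableSpace (Quot (CoverGlue s (coverClass s))))

/-- The point of `X_Γ` represented by a point of the `n`-th copy of the rectangle. -/
def Cover.mk {s : ℕ} (n : ℤ) (a : PRect s) : Cover s := Quot.mk (CoverGlue s (coverClass s)) (n, a)

/-- The projection `p : X_Γ → X` (its image is `X \ Σ`). -/
def proj (s : ℕ) : Cover s → Surface s :=
  Quot.lift (fun a => Surface.mk ⟨a.2.1, a.2.2.1⟩) (by
    rintro a b (⟨h1, h2, h3, -⟩ | ⟨k, hk, t, ht, h1, h2, -⟩)
    · exact Quot.sound (Or.inl ⟨h1, h2, h3⟩)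
    · exact Quot.sound (Or.inr ⟨k, hk, t, Set.Ioo_subset_Icc_self ht, h1, h2⟩))

/-- The deck transformation `Δ_m`, `m ∈ ℤ`. -/
def deck (s : ℕ) (m : ℤ) : Cover s → Cover s :=
  Quot.map (fun a => (a.1 + m, a.2)) (by
    rintro a b (⟨h1, h2, h3, h4⟩ | ⟨k, hk, t, ht, h1, h2, h3⟩)
    · exact Or.inl ⟨h1, h2, h3, by simp [h4]⟩
    · exact Or.inr ⟨k, hk, t, ht, h1, h2, by simp only [h3]; ring⟩)

/-! ### Linear automorphisms

All side identifications are translations by integer vectors. Hence the coordinates of the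
rectangle define a map from `X` to the torus `ℝ² / ℤ²`. Away from `Σ` it is a local homeomorphism,
and the translation charts of `X \ Σ` and of `X_Γ` are its local lifts to `ℝ²`. -/

/-- The torus `ℝ² / ℤ²`. -/
abbrev Torus : Type := UnitAddCircle × UnitAddCircle

/-- The class of a vector in the torus. -/
def toTorus (v : Fin 2 → ℝ) : Torus := ((v 0 : UnitAddCircle), (v 1 : UnitAddCircle))

lemma coe_natCast_circle (n : ℕ) : ((n : ℝ) : UnitAddCircle) = 0 := by
  rw [AddCircle.coe_eq_zero_iff]
  exact ⟨n, by simp⟩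

/-- The coordinates modulo `ℤ²` of a point of `X`. -/
def dev (s : ℕ) : Surface s → Torus :=
  Quot.lift (fun a => ((a.1.1 : UnitAddCircle), (a.1.2 : UnitAddCircle))) (by
    rintro a b (⟨h1, h2, h3⟩ | ⟨k, hk, t, ht, h1, h2⟩)
    · simp [h1, h2, h3, coe_natCast_circle]
    · simp [h1, h2, coe_natCast_circle])

/-- The coordinates modulo `ℤ²` of a point of `X_Γ`. -/
def devCover (s : ℕ) (y : Cover s) : Torus := dev s (proj s y)

/-- The (continuous) map `f` is affine with linear part `A` (acting on column vectors) in the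
translation charts given by `d`, near each point of `U`: if `q` is close to `p` and
`v` is the small vector from `p` to `q`, then `A v` is the vector from `f p` to `f q`. -/
def HasLinearPart {Y : Type} [TopologicalSpace Y] (d : Y → Torus) (U : Set Y) (f : Y → Y)
    (A : Matrix (Fin 2) (Fin 2) ℝ) : Prop :=
  ∀ p ∈ U, ∃ ε > 0, ∀ᶠ q in 𝓝 p, ∀ v : Fin 2 → ℝ, (∀ i, |v i| < ε) →
    d q = d p + toTorus v → d (f q) = d (f p) + toTorus (A.mulVec v)

/-- `ψ` is a linear automorphism of `(X, Σ)` with derivative `A`. -/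
structure IsLinearAutomorphism {s : ℕ} (ψ : Surface s ≃ₜ Surface s)
    (A : Matrix (Fin 2) (Fin 2) ℝ) : Prop where
  image_marked : ψ '' marked s = marked s
  linear : HasLinearPart (dev s) (marked s)ᶜ ψ A

/-- `ψ` is a linear pseudo-Anosov automorphism of `X`: its derivative is hyperbolic. -/
def IsLinearPseudoAnosov {s : ℕ} (ψ : Surface s ≃ₜ Surface s) : Prop :=
  ∃ A : Matrix (Fin 2) (Fin 2) ℝ, IsLinearAutomorphism ψ A ∧ A.det = 1 ∧ 2 < |A.trace|

/-- `τ` is a horizontal Dehn (multi-)twist: a linear automorphism with derivative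
`(1 t; 0 1)`, `t ≠ 0`, that fixes the boundary of the horizontal cylinder pointwise. -/
def IsHorizontalDehnTwist {s : ℕ} (τ : Surface s ≃ₜ Surface s) (t : ℝ) : Prop :=
  t ≠ 0 ∧ IsLinearAutomorphism τ !![1, t; 0, 1] ∧
  ∀ a : Rect s, a.1.2 = 0 → τ (Surface.mk a) = Surface.mk a

/-- `τ` is a vertical Dehn (multi-)twist: a linear automorphism with derivative `(1 0; t 1)`,
`t ≠ 0`, that fixes pointwise the vertical lines with integral abscissa, in particular the
boundaries of all vertical cylinders. -/
def IsVerticalDehnTwist {s : ℕ} (τ : Surface s ≃ₜ Surface s) (t : ℝ) : Prop :=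
  t ≠ 0 ∧ IsLinearAutomorphism τ !![1, 0; t, 1] ∧
  ∀ a : Rect s, (∃ k : ℕ, a.1.1 = k) → τ (Surface.mk a) = Surface.mk a

/-! ### Action on the cover -/

/-- `Ψ` is a lift of `ψ` to the cover. -/
def IsLift {s : ℕ} (Ψ : Cover s ≃ₜ Cover s) (ψ : Surface s ≃ₜ Surface s) : Prop :=
  ∀ y, proj s (Ψ y) = ψ (proj s y)

/-- `Ψ` commutes with all deck transformations. -/
def IsHomogeneous {s : ℕ} (Ψ : Cover s ≃ₜ Cover s) : Prop :=
  ∀ (m : ℤ) (y : Cover s), Ψ (deck s m y) = deck s m (Ψ y)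

/-- `ζ(γ) = n` for the homomorphism `ζ : π₁(X \ Σ) → ℤ` of the cover: the loop `γ` in `X \ Σ` has
a lift to the cover whose end point is the image of its initial point under `Δ_n`. -/
def HasCoverDegree {s : ℕ} (γ : C(unitInterval, Surface s)) (n : ℤ) : Prop :=
  ∃ γ' : C(unitInterval, Cover s), (∀ t, proj s (γ' t) = γ t) ∧ γ' 1 = deck s n (γ' 0)

/-- `ζ ∘ ψ_* = ζ`. -/
def PreservesCoverClass {s : ℕ} (ψ : Surface s ≃ₜ Surface s) : Prop :=
  ∀ (γ : C(unitInterval, Surface s)) (n : ℤ),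
    HasCoverDegree γ n → HasCoverDegree ((ψ : C(Surface s, Surface s)).comp γ) n

/-- `ζ ∘ ψ_* = -ζ`. -/
def ReversesCoverClass {s : ℕ} (ψ : Surface s ≃ₜ Surface s) : Prop :=
  ∀ (γ : C(unitInterval, Surface s)) (n : ℤ),
    HasCoverDegree γ n → HasCoverDegree ((ψ : C(Surface s, Surface s)).comp γ) (-n)

/-- `Ψ` is a homogeneous linear pseudo-Anosov automorphism of the cover, lifting the linear
pseudo-Anosov automorphism `ψ` of `X`. -/
structure IsHomogeneousLinearPseudoAnosov {s : ℕ} (Ψ : Cover s ≃ₜ Cover s)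
    (ψ : Surface s ≃ₜ Surface s) : Prop where
  pseudoAnosov : IsLinearPseudoAnosov ψ
  lift : IsLift Ψ ψ
  homogeneous : IsHomogeneous Ψ
  linear : ∃ A : Matrix (Fin 2) (Fin 2) ℝ,
    HasLinearPart (devCover s) Set.univ Ψ A ∧ A.det = 1 ∧ 2 < |A.trace|

/-! ### Average drift -/

/-- `ξ` is a `ℤ`-coordinate on the cover, i.e. `ξ y = n` if and only if `y ∈ Δ_n(𝓕)`, for the
measurable fundamental domain `𝓕 = {ξ = 0}`, which is bounded: it meets only finitely many copies
of the rectangle. -/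
structure IsCoordinate {s : ℕ} (ξ : Cover s → ℤ) : Prop where
  measurable : Measurable ξ
  deck : ∀ (m : ℤ) (y : Cover s), ξ (deck s m y) = ξ y + m
  bounded : ∃ N : ℤ, ∀ y, ξ y = 0 → ∃ (n : ℤ) (a : PRect s), |n| ≤ N ∧ Cover.mk n a = y

/-- `F : X → ℤ` is the Frobenius function of `Ψ` (determined on `X \ Σ`, thus almost everywhere). -/
def IsFrobenius {s : ℕ} (ξ : Cover s → ℤ) (Ψ : Cover s ≃ₜ Cover s) (F : Surface s → ℤ) : Prop :=
  ∀ y, F (proj s y) = ξ (Ψ y) - ξ y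

/-- The average drift `∫ F dm` of `Ψ` is well defined and zero, for every `ℤ`-coordinate (and there
are such coordinates). -/
def HasZeroAverageDrift {s : ℕ} (Ψ : Cover s ≃ₜ Cover s) : Prop :=
  (∃ ξ : Cover s → ℤ, IsCoordinate ξ) ∧
  ∀ ξ : Cover s → ℤ, IsCoordinate ξ → ∃ F : Surface s → ℤ, IsFrobenius ξ Ψ F ∧
    Integrable (fun x => (F x : ℝ)) (lebesgue s) ∧ ∫ x, (F x : ℝ) ∂(lebesgue s) = 0

end Staircase

end

noncomputable section

namespace Staircase

/-! ### Glued copies of the rectangle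

The surface and its cover are both quotients of copies of the rectangle, indexed by a group of
labels; they are treated simultaneously. -/

/-! Both `Surface s` and `Cover s` are made of rectangles glued in the same pattern; they differ
only in the labels and in the removal of the vertices. The maps are therefore constructed once, on a
`Model`, and used for `surfaceModel` (trivial labels) and `coverModel` (labels in `ℤ`).

Each rectangle closes up to a horizontal cylinder of circumference `s` and height 1 with constant
label. The shear `x ↦ x + s * y` is the identity at height 0 and a full turn at height 1, so it
respects the gluing. Vertically, column `k` is followed by column `perm s k` and then by `k` again,
and the label changes by `c k + c (perm s k) = 0`. So vertical lines close up at height 2 in the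
cover as well, and `y ↦ y + 2 * t` in each column is the identity on both its edges. The formulas do
not depend on the label: the maps upstairs are lifts of those downstairs and commute with the deck
group. The composition has trace `2 + 2 * s`.

Zero drift comes from a symmetry (`hasZeroAverageDrift_of_comm`). The rotation `(n, x, y) ↦ (-n, s -
x, 1 - y)` defines an involution `J` over `ι` that commutes with both twists, because conjugating a
shear by a half turn changes it only by a full period. For a coordinate `ξ` the function `H = ξ + ξ
∘ J` is deck invariant and bounded, hence lives on the surface, and `J ∘ Ψ = Ψ ∘ J` gives `F + F ∘ ι
= H ∘ ψ - H`. As `ψ` and `ι` preserve the measure, integration yields `2 ∫ F = 0`. Boundedness holds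
because the twists and `J` move labels by bounded amounts (up to the sign, for `J`), and any
coordinate stays at bounded distance from the label. -/

/-- The point `(x, y)` is not in the lattice `ℤ²`, if `b` holds. -/
def Free (b : Prop) (x y : ℝ) : Prop := b → ¬ ((∃ i : ℤ, x = i) ∧ ∃ j : ℤ, y = j)

/-- The rectangle, without its vertices if `b` holds. -/
def Dom (s : ℕ) (b : Prop) : Set (ℝ × ℝ) :=
  {z | z.1 ∈ Set.Icc (0 : ℝ) s ∧ z.2 ∈ Set.Icc (0 : ℝ) 1 ∧ Free b z.1 z.2}

/-- `Y` consists of copies of the rectangle (without vertices if `b` holds) with labels in `G`,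
glued as in the staircase surface; crossing the edge `k` upward changes the label by `c k`. -/
structure Model (s : ℕ) (G : Type) [AddCommGroup G] (c : ℕ → G) (b : Prop) (Y : Type)
    [TopologicalSpace Y] [MeasurableSpace Y] where
  q : G → ℝ → ℝ → Y
  cont : ∀ n, ContinuousOn (fun z : ℝ × ℝ => q n z.1 z.2) (Dom s b)
  meas : ∀ n, Measurable (fun z : ℝ × ℝ => q n z.1 z.2)
  side : ∀ n y, y ∈ Set.Icc (0 : ℝ) 1 → Free b 0 y → q n 0 y = q n s y
  top : ∀ n k t, k < s → t ∈ Set.Icc (0 : ℝ) 1 → Free b t 0 →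
    q n (k + t) 1 = q (n + c k) (perm s k + t) 0
  surj : ∀ y, ∃ n x z, (x, z) ∈ Dom s b ∧ q n x z = y
  lift : ∀ {Z : Type} (f : G → ℝ → ℝ → Z),
    (∀ n y, y ∈ Set.Icc (0 : ℝ) 1 → Free b 0 y → f n 0 y = f n s y) →
    (∀ n k t, k < s → t ∈ Set.Icc (0 : ℝ) 1 → Free b t 0 →
      f n (k + t) 1 = f (n + c k) (perm s k + t) 0) →
    ∃ F : Y → Z, ∀ n x y, (x, y) ∈ Dom s b → F (q n x y) = f n x y
  cont_lift : ∀ F : Y → Y, (∀ n, ContinuousOn (fun z : ℝ × ℝ => F (q n z.1 z.2)) (Dom s b)) →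
    Continuous F
  meas_lift : ∀ {Z : Type} [MeasurableSpace Z] (F : Y → Z) (f : G → ℝ × ℝ → Z),
    (∀ n, Measurable (f n)) → (∀ n, ∀ z ∈ Dom s b, F (q n z.1 z.2) = f n z) → Measurable F

/-! ### Preliminaries: locally finite covers, lattice points, columns -/

/-- Continuity on a set covered by a locally finite family of closed sets. -/
lemma continuousOn_of_locallyFinite_cover {X Y ι : Type*} [TopologicalSpace X]
    [TopologicalSpace Y] {g : X → Y} {D : Set X} {C : ι → Set X} (hf : LocallyFinite C)
    (hC : ∀ i, IsClosed (C i)) (hD : D ⊆ ⋃ i, C i) (hg : ∀ i, ContinuousOn g (D ∩ C i)) :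
    ContinuousOn g D := by
  rw [continuousOn_iff_continuous_domRestrict]
  refine LocallyFinite.continuous (f := fun i => (Subtype.val : D → X) ⁻¹' C i)
    (hf.preimage_continuous continuous_subtype_val) ?_
    (fun i => (hC i).preimage continuous_subtype_val) ?_
  · ext a
    simpa using hD a.2
  · intro i
    exact (hg i).comp continuous_subtype_val.continuousOn (fun a ha => ⟨a.2, ha⟩)

lemma locallyFinite_Icc_mul {a : ℝ} (ha : 0 < a) :
    LocallyFinite fun j : ℤ => Set.Icc (a * j) (a * (j + 1)) := by
  apply locallyFinite_Icc_of_tendsto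
  · exact tendsto_intCast_atTop_atTop.const_mul_atTop ha
  · refine Tendsto.const_mul_atBot ha ?_
    exact tendsto_atBot_add_const_right _ _ (tendsto_intCast_atBot_iff.2 tendsto_id)

/-- The translations, reflections and shears below are integral with integral inverse, so a lattice
point can only come from a lattice point. This is what keeps the twists inside the punctured
rectangles of the cover. -/
lemma Free.of_lattice {b : Prop} {x y x' y' : ℝ} (h : Free b x y)
    (hl : ∀ i j : ℤ, x' = i → y' = j → (∃ i' : ℤ, x = i') ∧ ∃ j' : ℤ, y = j') : Free b x' y' := by
  rintro hb ⟨⟨i, hi⟩, j, hj⟩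
  exact h hb (hl i j hi hj)

lemma Free.add_int {b : Prop} {x y : ℝ} (h : Free b x y) (m n : ℤ) : Free b (x + m) (y + n) :=
  h.of_lattice fun i j hi hj =>
    ⟨⟨i - m, by push_cast; linarith⟩, ⟨j - n, by push_cast; linarith⟩⟩

lemma Free.int_sub {b : Prop} {x y : ℝ} (h : Free b x y) (m n : ℤ) : Free b (m - x) (n - y) :=
  h.of_lattice fun i j hi hj =>
    ⟨⟨m - i, by push_cast; linarith⟩, ⟨n - j, by push_cast; linarith⟩⟩

lemma Free.horizontal_shear {b : Prop} {x y : ℝ} (h : Free b x y) (m : ℤ) :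
    Free b (x + m * y) y :=
  h.of_lattice fun i j hi hj =>
    ⟨⟨i - m * j, by push_cast; rw [← hj]; linarith⟩, ⟨j, hj⟩⟩

lemma Free.vertical_shear {b : Prop} {x y : ℝ} (h : Free b x y) (m : ℤ) :
    Free b x (y + m * x) :=
  h.of_lattice fun i j hi hj =>
    ⟨⟨i, hi⟩, ⟨j - m * i, by push_cast; rw [← hi]; linarith⟩⟩

lemma perm_perm (s k : ℕ) : perm s (perm s k) = k := Equiv.swap_apply_self _ _ _

lemma perm_lt {s k : ℕ} (hk : k < s) : perm s k < s := by
  unfold perm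
  rw [Equiv.swap_apply_def]
  split_ifs <;> omega

/-- Reversing the order of the intervals commutes with exchanging the first and the last one. -/
lemma perm_reflect {s k : ℕ} (hk : k < s) : perm s (s - 1 - perm s k) = s - 1 - k := by
  unfold perm
  simp only [Equiv.swap_apply_def]
  split_ifs <;> omega

/-- Points of the rectangle lie in columns. -/
lemma exists_column {s : ℕ} (hs : 2 ≤ s) {x : ℝ} (hx : x ∈ Set.Icc (0 : ℝ) s) :
    ∃ k : ℕ, k < s ∧ ∃ t ∈ Set.Icc (0 : ℝ) 1, x = k + t := by
  rcases eq_or_lt_of_le hx.2 with h | h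
  · refine ⟨s - 1, by omega, 1, by simp, ?_⟩
    rw [h, Nat.cast_sub (by omega)]; simp
  · refine ⟨⌊x⌋₊, (Nat.floor_lt hx.1).2 h, x - ⌊x⌋₊, ⟨?_, ?_⟩, by ring⟩
    · linarith [Nat.floor_le hx.1]
    · linarith [Nat.lt_floor_add_one x]

lemma column_mem {s k : ℕ} (hk : k < s) {t : ℝ} (ht : t ∈ Set.Icc (0 : ℝ) 1) :
    (k : ℝ) + t ∈ Set.Icc (0 : ℝ) s := by
  have : (k : ℝ) + 1 ≤ s := by exact_mod_cast hk
  exact ⟨by linarith [ht.1, (Nat.cast_nonneg k : (0 : ℝ) ≤ k)], by linarith [ht.2]⟩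

lemma free_column {b : Prop} {t y : ℝ} (k : ℕ) : Free b (k + t) y ↔ Free b t y := by
  constructor
  · intro h; simpa using h.add_int (-k) 0
  · intro h; simpa [add_comm] using h.add_int k 0

lemma column_mem_dom {s k : ℕ} {b : Prop} (hk : k < s) {t y : ℝ} (ht : t ∈ Set.Icc (0 : ℝ) 1)
    (hy : y ∈ Set.Icc (0 : ℝ) 1) (h : Free b t y) : ((k : ℝ) + t, y) ∈ Dom s b :=
  ⟨column_mem hk ht, hy, (free_column k).2 h⟩

/-! ### Horizontal and vertical lines as periodic curves -/

namespace Model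

variable {s : ℕ} {G : Type} [AddCommGroup G] {c : ℕ → G} {b : Prop} {Y : Type}
  [TopologicalSpace Y] [MeasurableSpace Y] (M : Model s G c b Y)

/-- The horizontal line of height `y`, periodically extended to `x ∈ ℝ`. -/
def hline (n : G) (x y : ℝ) : Y := M.q n (x - s * ⌊x / s⌋) y

/-- The vertical line in the column `k` above `(k + t, 0)`, extended to all heights `y ∈ ℝ` by
following the surface upward and downward. -/
def vline (n : G) (k : ℕ) (t y : ℝ) : Y :=
  if Even ⌊y⌋ then M.q n (k + t) (Int.fract y) else M.q (n + c k) (perm s k + t) (Int.fract y)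

lemma hline_add_period (hs : 2 ≤ s) (n : G) (x y : ℝ) (j : ℤ) :
    M.hline n (x + s * j) y = M.hline n x y := by
  have h0 : (s : ℝ) ≠ 0 := by positivity
  unfold hline
  have : (x + s * j) / s = x / s + j := by field_simp
  rw [this, Int.floor_add_intCast]
  push_cast
  congr 1
  ring

/-- Only `x = s` needs an argument: there the floor has already jumped, and the side gluing
identifies the two values. -/
lemma hline_of_mem (hs : 2 ≤ s) (n : G) {x y : ℝ} (h : (x, y) ∈ Dom s b) :
    M.hline n x y = M.q n x y := by
  have h0 : (0 : ℝ) < s := by positivity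
  obtain ⟨h1, h2, h3⟩ := h
  rcases eq_or_lt_of_le h1.2 with h | h
  · simp only at h
    subst h
    have : Free b 0 y := by simpa using h3.add_int (-s) 0
    unfold hline
    rw [div_self h0.ne', ← M.side n y h2 this]
    simp
  · have : ⌊x / s⌋ = 0 := by
      rw [Int.floor_eq_zero_iff]
      exact ⟨div_nonneg h1.1 h0.le, (div_lt_one h0).2 h⟩
    simp [hline, this]

lemma continuousOn_hline (hs : 2 ≤ s) (n : G) :
    ContinuousOn (fun z : ℝ × ℝ => M.hline n z.1 z.2)
      {z | z.2 ∈ Set.Icc (0 : ℝ) 1 ∧ Free b z.1 z.2} := by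
  have h0 : (0 : ℝ) < s := by positivity
  refine continuousOn_of_locallyFinite_cover
    (C := fun j : ℤ => Prod.fst ⁻¹' Set.Icc ((s : ℝ) * j) (s * (j + 1)))
    ((locallyFinite_Icc_mul h0).preimage_continuous continuous_fst)
    (fun j => isClosed_Icc.preimage continuous_fst) ?_ ?_
  · intro z _
    refine Set.mem_iUnion.2 ⟨⌊z.1 / s⌋, ?_, ?_⟩
    · have := Int.floor_le (z.1 / s)
      rw [le_div_iff₀ h0] at this; linarith
    · have := (Int.lt_floor_add_one (z.1 / s)).le
      rw [div_le_iff₀ h0] at this; linarith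
  · intro j
    have hmap : Set.MapsTo (fun z : ℝ × ℝ => (z.1 - s * j, z.2))
        ({z | z.2 ∈ Set.Icc (0 : ℝ) 1 ∧ Free b z.1 z.2} ∩
          Prod.fst ⁻¹' Set.Icc ((s : ℝ) * j) (s * (j + 1))) (Dom s b) := by
      rintro z ⟨⟨h1, h2⟩, h3, h4⟩
      refine ⟨⟨?_, ?_⟩, h1, ?_⟩
      · simp only; linarith
      · simp only; linarith
      · have := h2.add_int (-(s * j)) 0
        simpa [sub_eq_add_neg] using this
    refine ((M.cont n).comp (by fun_prop) hmap).congr ?_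
    intro z hz
    rw [Function.comp_apply]
    rw [← M.hline_of_mem hs n (hmap hz), ← M.hline_add_period hs n _ z.2 j]
    simp

lemma measurable_hline (n : G) : Measurable (fun z : ℝ × ℝ => M.hline n z.1 z.2) :=
  (M.meas n).comp (f := fun z : ℝ × ℝ => (z.1 - s * ⌊z.1 / s⌋, z.2)) (by fun_prop)

/-- A line that starts in the second rectangle of its period must return to label `n`; this is where
`c (perm s k) = - c k` enters. -/
lemma vline_add_one (hc : ∀ k < s, c (perm s k) = - c k) (n : G) {k : ℕ} (hk : k < s) (t y : ℝ) :
    M.vline n k t (y + 1) = M.vline (n + c k) (perm s k) t y := by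
  unfold vline
  simp only [Int.floor_add_one, Int.fract_add_one, perm_perm, hc k hk, add_neg_cancel_right,
    Int.even_add_one]
  split_ifs <;> rfl

lemma vline_add_two (n : G) (k : ℕ) (t y : ℝ) (j : ℤ) : M.vline n k t (y + 2 * j) = M.vline n k t y := by
  unfold vline
  have h1 : ⌊y + 2 * (j : ℝ)⌋ = ⌊y⌋ + 2 * j := by
    exact_mod_cast Int.floor_add_intCast y (2 * j)
  have h2 : Int.fract (y + 2 * (j : ℝ)) = Int.fract y := by
    exact_mod_cast Int.fract_add_intCast y (2 * j)
  rw [h1, h2]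
  simp [Int.even_add]

lemma vline_sub_one (hc : ∀ k < s, c (perm s k) = - c k) (n : G) {k : ℕ} (hk : k < s) (t y : ℝ) :
    M.vline n k t (y - 1) = M.vline (n + c k) (perm s k) t y := by
  rw [← M.vline_add_two n k t (y - 1) 1, ← M.vline_add_one hc n hk]
  congr 1; push_cast; ring

/-- The definition of `vline` changes rectangles already at `y = 1`; the gluing `top` shows that the
old rectangle gives the same point, so the formula holds on the closed rectangle. Continuity across
the horizontal sides rests on this. -/
lemma vline_of_mem (n : G) {k : ℕ} (hk : k < s) {t y : ℝ} (ht : t ∈ Set.Icc (0 : ℝ) 1)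
    (hy : y ∈ Set.Icc (0 : ℝ) 1) (h : Free b t y) : M.vline n k t y = M.q n (k + t) y := by
  unfold vline
  rcases eq_or_lt_of_le hy.2 with h1 | h1
  · subst h1
    have h0 : Free b t 0 := by simpa using h.add_int 0 (-1)
    rw [M.top n k t hk ht h0]
    simp
  · have h2 : ⌊y⌋ = 0 := Int.floor_eq_zero_iff.2 ⟨hy.1, h1⟩
    rw [Int.fract_eq_self.2 ⟨hy.1, h1⟩, h2]
    simp

lemma continuousOn_vline (hc : ∀ k < s, c (perm s k) = - c k) (n : G) {k : ℕ} (hk : k < s) :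
    ContinuousOn (fun z : ℝ × ℝ => M.vline n k z.1 z.2)
      {z | z.1 ∈ Set.Icc (0 : ℝ) 1 ∧ Free b z.1 z.2} := by
  refine continuousOn_of_locallyFinite_cover
    (C := fun j : ℤ => Prod.snd ⁻¹' Set.Icc ((1 : ℝ) * j) (1 * (j + 1)))
    ((locallyFinite_Icc_mul one_pos).preimage_continuous continuous_snd)
    (fun j => isClosed_Icc.preimage continuous_snd) ?_ ?_
  · intro z _
    refine Set.mem_iUnion.2 ⟨⌊z.2⌋, ?_, ?_⟩
    · linarith [Int.floor_le z.2]
    · linarith [Int.lt_floor_add_one z.2]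
  · intro j
    have hmap : ∀ l < s, Set.MapsTo (fun z : ℝ × ℝ => ((l : ℝ) + z.1, z.2 - j))
        ({z | z.1 ∈ Set.Icc (0 : ℝ) 1 ∧ Free b z.1 z.2} ∩
          Prod.snd ⁻¹' Set.Icc ((1 : ℝ) * j) (1 * (j + 1))) (Dom s b) := by
      rintro l hl z ⟨⟨h1, h2⟩, h3, h4⟩
      refine column_mem_dom hl h1 ⟨?_, ?_⟩ ?_
      · linarith
      · linarith
      · simpa [sub_eq_add_neg] using h2.add_int 0 (-j)
    have hfree : ∀ z ∈ ({z : ℝ × ℝ | z.1 ∈ Set.Icc (0 : ℝ) 1 ∧ Free b z.1 z.2} ∩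
          Prod.snd ⁻¹' Set.Icc ((1 : ℝ) * j) (1 * (j + 1))),
        z.2 - j ∈ Set.Icc (0 : ℝ) 1 ∧ Free b z.1 (z.2 - j) := fun z hz =>
      ⟨(hmap k hk hz).2.1, (free_column k).1 (hmap k hk hz).2.2⟩
    -- On an even strip the line is back in column `k` with label `n`; on an odd strip it has
    -- effectively crossed one top side.
    rcases Int.even_or_odd' j with ⟨i, hi | hi⟩
    · refine ((M.cont n).comp (by fun_prop) (hmap k hk)).congr ?_
      intro z hz
      rw [Function.comp_apply]
      simp only
      rw [← M.vline_of_mem n hk hz.1.1 (hfree z hz).1 (hfree z hz).2,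
        ← M.vline_add_two n k _ (z.2 - j) i]
      congr 1; rw [hi]; push_cast; ring
    · refine ((M.cont (n + c k)).comp (by fun_prop) (hmap _ (perm_lt hk))).congr ?_
      intro z hz
      rw [Function.comp_apply]
      simp only
      rw [← M.vline_of_mem _ (perm_lt hk) hz.1.1 (hfree z hz).1 (hfree z hz).2,
        ← M.vline_add_one hc n hk, ← M.vline_add_two n k _ (z.2 - j + 1) i]
      congr 1; rw [hi]; push_cast; ring

lemma measurable_vline (n : G) (k : ℕ) : Measurable (fun z : ℝ × ℝ => M.vline n k z.1 z.2) := by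
  have h : ∀ (m : G) (l : ℕ),
      Measurable (fun z : ℝ × ℝ => M.q m (l + z.1) (Int.fract z.2)) := fun m l =>
    (M.meas m).comp (f := fun z : ℝ × ℝ => ((l : ℝ) + z.1, Int.fract z.2))
      ((measurable_const.add measurable_fst).prodMk (measurable_fract.comp measurable_snd))
  refine Measurable.ite ?_ (h n k) (h _ _)
  exact (Int.measurable_floor.comp measurable_snd) (t := {j | Even j}) (by measurability)

end Model

/-! ### The twists and the rotation on a model -/

/-- The column of a point of `[0, s]`; on the common boundary of two columns, the right one. -/
def column (s : ℕ) (x : ℝ) : ℕ := min ⌊x⌋₊ (s - 1)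

lemma measurable_column (s : ℕ) : Measurable (column s) :=
  Nat.measurable_floor.min measurable_const

lemma column_add {s k : ℕ} (hs : 2 ≤ s) (hk : k < s) {t : ℝ} (ht : t ∈ Set.Icc (0 : ℝ) 1) :
    column s (k + t) = k ∨ (t = 1 ∧ k + 1 < s ∧ column s (k + t) = k + 1) := by
  unfold column
  rcases eq_or_lt_of_le ht.2 with h | h
  · subst h
    have : ⌊(k : ℝ) + 1⌋₊ = k + 1 := by exact_mod_cast Nat.floor_natCast (R := ℝ) (k + 1)
    rw [this]
    rcases lt_or_ge (k + 1) s with h1 | h1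
    · exact Or.inr ⟨rfl, h1, min_eq_left (by omega)⟩
    · exact Or.inl ((min_eq_right (by omega)).trans (by omega))
  · left
    have : ⌊(k : ℝ) + t⌋₊ = k := by
      rw [Nat.floor_eq_iff (by linarith [ht.1, (Nat.cast_nonneg k : (0 : ℝ) ≤ k)])]
      exact ⟨by linarith [ht.1], by linarith⟩
    rw [this]
    exact min_eq_left (by omega)

lemma sub_floor_mem_dom {s : ℕ} {b : Prop} (hs : 2 ≤ s) {x y : ℝ} (hy : y ∈ Set.Icc (0 : ℝ) 1)
    (h : Free b x y) : (x - s * ⌊x / s⌋, y) ∈ Dom s b := by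
  have h0 : (0 : ℝ) < s := by positivity
  refine ⟨⟨?_, ?_⟩, hy, ?_⟩
  · have := Int.floor_le (x / s)
    rw [le_div_iff₀ h0] at this; simp only; linarith
  · have := (Int.lt_floor_add_one (x / s)).le
    rw [div_le_iff₀ h0] at this; simp only; linarith
  · simpa [sub_eq_add_neg] using h.add_int (-(s * ⌊x / s⌋)) 0

namespace Model

variable {s : ℕ} {G : Type} [AddCommGroup G] {c : ℕ → G} {b : Prop} {Y : Type}
  [TopologicalSpace Y] [MeasurableSpace Y] (M : Model s G c b Y)

lemma hline_eq (hs : 2 ≤ s) (n : G) {x y : ℝ} (hy : y ∈ Set.Icc (0 : ℝ) 1) (h : Free b x y) :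
    ∃ (x' : ℝ) (j : ℤ), x = x' + s * j ∧ (x', y) ∈ Dom s b ∧ M.hline n x y = M.q n x' y :=
  ⟨_, _, by ring, sub_floor_mem_dom hs hy h, rfl⟩

/-- Points of vertical lines lie in the rectangle. -/
lemma vline_eq (n : G) {k : ℕ} (hk : k < s) {t y : ℝ} (h : Free b t y) : ∃ l < s, ∃ y' ∈ Set.Icc (0 : ℝ) 1, Free b t y' ∧
      ∃ j : ℤ, ((l = k ∧ M.vline n k t y = M.q n (l + t) y' ∧ y = y' + 2 * j) ∨
        (l = perm s k ∧ M.vline n k t y = M.q (n + c k) (l + t) y' ∧ y = y' + 1 + 2 * j)) := by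
  have h1 : Int.fract y ∈ Set.Icc (0 : ℝ) 1 := ⟨Int.fract_nonneg y, (Int.fract_lt_one y).le⟩
  have h2 : Free b t (Int.fract y) := by
    simpa [Int.fract, sub_eq_add_neg] using h.add_int 0 (-⌊y⌋)
  have h3 := Int.floor_add_fract y
  unfold vline
  rcases Int.even_or_odd' ⌊y⌋ with ⟨j, hj | hj⟩
  · refine ⟨k, hk, _, h1, h2, j, Or.inl ⟨rfl, ?_, ?_⟩⟩
    · rw [if_pos (by rw [hj]; simp)]
    · rw [hj] at h3; push_cast at h3; linarith
  · refine ⟨_, perm_lt hk, _, h1, h2, j, Or.inr ⟨rfl, ?_, ?_⟩⟩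
    · rw [if_neg (by rw [hj]; simp)]
    · rw [hj] at h3; push_cast at h3; linarith

/-- A property of all points holds if it holds for the points of the columns. -/
lemma column_induction (hs : 2 ≤ s) {p : Y → Prop}
    (h : ∀ n, ∀ k < s, ∀ t ∈ Set.Icc (0 : ℝ) 1, ∀ y ∈ Set.Icc (0 : ℝ) 1, Free b t y →
      p (M.q n (k + t) y)) (y : Y) : p y := by
  obtain ⟨n, x, z, ⟨h1, h2, h3⟩, rfl⟩ := M.surj y
  obtain ⟨k, hk, t, ht, rfl⟩ := exists_column hs h1
  exact h n k hk t ht z h2 ((free_column k).1 h3)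

lemma exists_horizontal (hs : 2 ≤ s) (e : ℤ) : ∃ F : Y → Y, Continuous F ∧ Measurable F ∧
    ∀ n x y, y ∈ Set.Icc (0 : ℝ) 1 → Free b x y →
      F (M.hline n x y) = M.hline n (x + ((s * e : ℤ) : ℝ) * y) y := by
  obtain ⟨F, hF⟩ := M.lift (fun n x y => M.hline n (x + ((s * e : ℤ) : ℝ) * y) y) (by
      intro n y hy h
      rw [← M.hline_add_period hs n _ y 1]
      congr 1; push_cast; ring) (by
      intro n k t hk ht h
      have h1 : Free b t 1 := by simpa using h.add_int 0 1
      have h0 : (0 : ℝ) ∈ Set.Icc (0 : ℝ) 1 := by simp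
      have h0' : (1 : ℝ) ∈ Set.Icc (0 : ℝ) 1 := by simp
      -- At height 1 the shear is a translation by `e` full periods and at height 0 it is trivial,
      -- so both horizontal sides are fixed pointwise and the gluing is respected.
      have := M.hline_add_period hs n (k + t) 1 e
      push_cast
      rw [mul_one, this, mul_zero, add_zero, M.hline_of_mem hs n (column_mem_dom hk ht h0' h1),
        M.hline_of_mem hs _ (column_mem_dom (perm_lt hk) ht h0 h), M.top n k t hk ht h])
  refine ⟨F, M.cont_lift F fun n => ?_, M.meas_lift F _ (fun n => ?_) (fun n z hz => hF n _ _ hz),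
    fun n x y hy h => ?_⟩
  · refine ContinuousOn.congr ?_ (fun z hz => hF n z.1 z.2 hz)
    exact (M.continuousOn_hline hs n).comp
      (f := fun z : ℝ × ℝ => (z.1 + ((s * e : ℤ) : ℝ) * z.2, z.2))
      (by fun_prop) (fun z hz => ⟨hz.2.1, hz.2.2.horizontal_shear _⟩)
  · exact (M.measurable_hline n).comp
      (f := fun z : ℝ × ℝ => (z.1 + ((s * e : ℤ) : ℝ) * z.2, z.2)) (by fun_prop)
  · obtain ⟨x', j, rfl, h2, h3⟩ := M.hline_eq hs n hy h
    rw [h3, hF _ _ _ h2, ← M.hline_add_period hs n _ y j]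
    congr 1; ring

lemma exists_vertical (hs : 2 ≤ s) (hc : ∀ k < s, c (perm s k) = - c k) (e : ℤ) :
    ∃ F : Y → Y, Continuous F ∧ Measurable F ∧
      ∀ n, ∀ k < s, ∀ t ∈ Set.Icc (0 : ℝ) 1, ∀ y, Free b t y →
        F (M.vline n k t y) = M.vline n k t (y + ((2 * e : ℤ) : ℝ) * t) := by
  set f : G → ℝ → ℝ → Y := fun n x y =>
    M.vline n (column s x) (x - column s x) (y + ((2 * e : ℤ) : ℝ) * (x - column s x)) with hf
  -- On an edge common to two columns `f` uses the right one, with `t = 0`. The left one has `t = 1`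
  -- and a shift by `e` periods of length 2. Both leave the point fixed, so the formula is valid on
  -- every closed column.
  have key : ∀ n, ∀ k < s, ∀ t ∈ Set.Icc (0 : ℝ) 1, ∀ y ∈ Set.Icc (0 : ℝ) 1, Free b t y →
      f n (k + t) y = M.vline n k t (y + ((2 * e : ℤ) : ℝ) * t) := by
    intro n k hk t ht y hy h
    rcases column_add hs hk ht with h1 | ⟨rfl, h2, h3⟩
    · simp [hf, h1]
    · have h0 : Free b 0 y := by simpa using h.add_int (-1) 0
      have h4 := M.vline_add_two n k 1 y e
      simp only [hf, h3]
      push_cast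
      rw [mul_one, h4, M.vline_of_mem n hk ht hy h]
      simp only [sub_self, mul_zero, add_zero]
      rw [M.vline_of_mem n h2 (by simp) hy h0]
      congr 1; push_cast; ring
  have top : ∀ n k t, k < s → t ∈ Set.Icc (0 : ℝ) 1 → Free b t 0 →
      f n (k + t) 1 = f (n + c k) (perm s k + t) 0 := by
    intro n k t hk ht h
    have h1 : Free b t 1 := by simpa using h.add_int 0 1
    rw [key n k hk t ht 1 (by simp) h1, key _ _ (perm_lt hk) t ht 0 (by simp) h,
      ← M.vline_add_one hc n hk]
    congr 1; ring
  have side : ∀ n y, y ∈ Set.Icc (0 : ℝ) 1 → Free b 0 y → f n 0 y = f n s y := by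
    intro n y hy h
    have h1 : Free b 1 y := by simpa using h.add_int 1 0
    have e1 := key n 0 (by omega) 0 (by simp) y hy h
    have e2 := key n (s - 1) (by omega) 1 (by simp) y hy h1
    have h3 : ((s - 1 : ℕ) : ℝ) + 1 = s := by rw [Nat.cast_sub (by omega)]; simp
    rw [h3] at e2
    have h4 := M.vline_add_two n (s - 1) 1 y e
    push_cast at e1 e2
    rw [mul_one, h4, M.vline_of_mem n (by omega) (by simp) hy h1, h3, ← M.side n y hy h] at e2
    simp only [mul_zero, add_zero] at e1
    rw [M.vline_of_mem n (k := 0) (by omega) (by simp) hy h] at e1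
    rw [e2]
    simpa using e1
  obtain ⟨F, hF⟩ := M.lift f side top
  have hFk : ∀ n, ∀ k < s, ∀ t ∈ Set.Icc (0 : ℝ) 1, ∀ y ∈ Set.Icc (0 : ℝ) 1, Free b t y →
      F (M.q n (k + t) y) = M.vline n k t (y + ((2 * e : ℤ) : ℝ) * t) := by
    intro n k hk t ht y hy h
    rw [hF n _ _ (column_mem_dom hk ht hy h), key n k hk t ht y hy h]
  refine ⟨F, M.cont_lift F fun n => ?_, M.meas_lift F (fun n z => f n z.1 z.2) (fun n => ?_)
    (fun n z hz => hF n _ _ hz), fun n k hk t ht y h => ?_⟩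
  · refine continuousOn_of_locallyFinite_cover
      (C := fun k : Fin s => Prod.fst ⁻¹' Set.Icc (k : ℝ) (k + 1)) (locallyFinite_of_finite _)
      (fun k => isClosed_Icc.preimage continuous_fst) ?_ ?_
    · intro z hz
      obtain ⟨k, hk, t, ht, hx⟩ := exists_column hs hz.1
      refine Set.mem_iUnion.2 ⟨⟨k, hk⟩, ?_, ?_⟩
      · simp only; linarith [ht.1]
      · simp only; linarith [ht.2]
    · intro k
      have hz' : ∀ z ∈ Dom s b ∩ Prod.fst ⁻¹' Set.Icc (k : ℝ) (k + 1),
          z.1 - k ∈ Set.Icc (0 : ℝ) 1 ∧ Free b (z.1 - k) z.2 := fun z hz =>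
        ⟨⟨by linarith [hz.2.1], by linarith [hz.2.2]⟩,
          (free_column (k : ℕ)).1 (by simpa using hz.1.2.2)⟩
      refine ((M.continuousOn_vline hc n k.2).comp
        (f := fun z : ℝ × ℝ => (z.1 - k, z.2 + ((2 * e : ℤ) : ℝ) * (z.1 - k)))
        (by fun_prop) (fun z hz => ⟨(hz' z hz).1, (hz' z hz).2.vertical_shear _⟩)).congr ?_
      intro z hz
      have := hFk n k k.2 (z.1 - k) (hz' z hz).1 z.2 hz.1.2.1 (hz' z hz).2
      rwa [add_sub_cancel] at this
  -- The formula depends on the column, but the column takes countably many values: measurability in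
  -- the column and the point jointly reduces to each fixed column.
  · have h1 : Measurable fun w : ℕ × (ℝ × ℝ) => M.vline n w.1 w.2.1 w.2.2 :=
      measurable_from_prod_countable_right fun k => M.measurable_vline n k
    refine h1.comp (f := fun z : ℝ × ℝ => (column s z.1, (z.1 - column s z.1,
      z.2 + ((2 * e : ℤ) : ℝ) * (z.1 - column s z.1)))) ?_
    have h2 : Measurable fun z : ℝ × ℝ => column s z.1 := (measurable_column s).comp measurable_fst
    have h3 : Measurable fun z : ℝ × ℝ => z.1 - column s z.1 :=
      measurable_fst.sub (measurable_from_nat.comp h2)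
    exact h2.prodMk (h3.prodMk (measurable_snd.add (h3.const_mul _)))
  · obtain ⟨l, hl, y', hy', h', j, ⟨rfl, h1, rfl⟩ | ⟨rfl, h1, rfl⟩⟩ := M.vline_eq n hk h
    · rw [h1, hFk n _ hl t ht y' hy' h', ← M.vline_add_two n _ _ _ j]
      congr 1; ring
    · rw [h1, hFk _ _ hl t ht y' hy' h', ← M.vline_add_one hc n hk, ← M.vline_add_two n _ _ _ j]
      congr 1; ring

lemma exists_reflection (hs : 2 ≤ s) (hc' : ∀ k < s, c (perm s (s - 1 - k)) = c k) :
    ∃ F : Y → Y, Continuous F ∧ Measurable F ∧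
      ∀ n x y, (x, y) ∈ Dom s b → F (M.q n x y) = M.q (-n) (s - x) (1 - y) := by
  have hd : ∀ z ∈ Dom s b, (s - z.1, 1 - z.2) ∈ Dom s b := by
    rintro z ⟨⟨h1, h2⟩, ⟨h3, h4⟩, h5⟩
    refine ⟨⟨?_, ?_⟩, ⟨?_, ?_⟩, by simpa using h5.int_sub s 1⟩ <;> simp only <;> linarith
  obtain ⟨F, hF⟩ := M.lift (fun n x y => M.q (-n) (s - x) (1 - y)) (by
      rintro n y ⟨h1, h2⟩ h
      have := M.side (-n) (1 - y) ⟨by linarith, by linarith⟩ (by simpa using h.int_sub 0 1)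
      simpa using this.symm) (by
      intro n k t hk ht h
      -- The half turn sends the bottom edge `perm s k` to the top edge `s - 1 - perm s k`, which is
      -- glued to the bottom edge `s - 1 - k`, the image of the top edge `k`. The labels match
      -- because this edge has the same coefficient `c k`.
      have hr : s - 1 - perm s k < s := by omega
      have h1 := M.top (-(n + c k)) (s - 1 - perm s k) (1 - t) hr
        ⟨by linarith [ht.2], by linarith [ht.1]⟩ (by simpa using h.int_sub 1 0)
      have hp := perm_lt hk
      have e1 : c (s - 1 - perm s k) = c k := by
        have := hc' (s - 1 - perm s k) hr
        rw [show s - 1 - (s - 1 - perm s k) = perm s k by omega, perm_perm] at this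
        exact this.symm
      have e2 : ((s - 1 : ℕ) : ℝ) = s - 1 := by rw [Nat.cast_sub (by omega)]; simp
      rw [perm_reflect hk, e1, neg_add, neg_add_cancel_right,
        Nat.cast_sub (show perm s k ≤ s - 1 by omega), Nat.cast_sub (show k ≤ s - 1 by omega),
        e2] at h1
      simp only [sub_self, sub_zero]
      convert h1.symm using 2
      · ring
      · abel
      · ring)
  refine ⟨F, M.cont_lift F fun n => ?_, M.meas_lift F (fun n z => M.q (-n) (s - z.1) (1 - z.2))
    (fun n => ?_) (fun n z hz => hF n _ _ hz), hF⟩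
  · refine ContinuousOn.congr ?_ (fun z hz => hF n z.1 z.2 hz)
    exact (M.cont (-n)).comp (f := fun z : ℝ × ℝ => (s - z.1, 1 - z.2)) (by fun_prop) hd
  · exact (M.meas (-n)).comp (f := fun z : ℝ × ℝ => (s - z.1, 1 - z.2)) (by fun_prop)

/-- The horizontal twist. -/
theorem exists_horizontal_homeomorph (hs : 2 ≤ s) : ∃ T : Y ≃ₜ Y, Measurable T ∧
    ∀ n x y, y ∈ Set.Icc (0 : ℝ) 1 → Free b x y →
      T (M.hline n x y) = M.hline n (x + s * y) y := by
  obtain ⟨F, hF, hm, h⟩ := M.exists_horizontal hs 1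
  -- The inverse is the shear in the opposite direction; this is why the construction allows any
  -- integer `e`.
  obtain ⟨F', hF', -, h'⟩ := M.exists_horizontal hs (-1)
  have h1 : ∀ y, F' (F y) = y ∧ F (F' y) = y := by
    intro y
    obtain ⟨n, x, z, hd, rfl⟩ := M.surj y
    have := hd.2.2
    rw [← M.hline_of_mem hs n hd, h n x z hd.2.1 hd.2.2,
      h' n _ z hd.2.1 (hd.2.2.horizontal_shear _), h' n x z hd.2.1 hd.2.2,
      h n _ z hd.2.1 (hd.2.2.horizontal_shear _)]
    constructor <;> · congr 1; push_cast; ring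
  refine ⟨⟨⟨F, F', fun y => (h1 y).1, fun y => (h1 y).2⟩, hF, hF'⟩, hm, fun n x y hy hf => ?_⟩
  refine (h n x y hy hf).trans ?_
  simp

/-- The vertical multitwist. -/
theorem exists_vertical_homeomorph (hs : 2 ≤ s) (hc : ∀ k < s, c (perm s k) = - c k) :
    ∃ T : Y ≃ₜ Y, Measurable T ∧
      ∀ n, ∀ k < s, ∀ t ∈ Set.Icc (0 : ℝ) 1, ∀ y, Free b t y →
        T (M.vline n k t y) = M.vline n k t (y + 2 * t) := by
  obtain ⟨F, hF, hm, h⟩ := M.exists_vertical hs hc 1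
  obtain ⟨F', hF', -, h'⟩ := M.exists_vertical hs hc (-1)
  have h1 : ∀ y, F' (F y) = y ∧ F (F' y) = y := by
    refine M.column_induction hs fun n k hk t ht y hy hf => ?_
    rw [← M.vline_of_mem n hk ht hy hf, h n k hk t ht y hf,
      h' n k hk t ht _ (hf.vertical_shear _), h' n k hk t ht y hf,
      h n k hk t ht _ (hf.vertical_shear _)]
    constructor <;> · congr 1; push_cast; ring
  refine ⟨⟨⟨F, F', fun y => (h1 y).1, fun y => (h1 y).2⟩, hF, hF'⟩, hm, fun n k hk t ht y hf => ?_⟩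
  refine (h n k hk t ht y hf).trans ?_
  simp

/-- The rotation by `π`. -/
theorem exists_reflection_homeomorph (hs : 2 ≤ s) (hc' : ∀ k < s, c (perm s (s - 1 - k)) = c k) :
    ∃ T : Y ≃ₜ Y, Measurable T ∧ (∀ y, T (T y) = y) ∧
      ∀ n x y, (x, y) ∈ Dom s b → T (M.q n x y) = M.q (-n) (s - x) (1 - y) := by
  obtain ⟨F, hF, hm, h⟩ := M.exists_reflection hs hc'
  have hd : ∀ z ∈ Dom s b, (s - z.1, 1 - z.2) ∈ Dom s b := by
    rintro z ⟨⟨h1, h2⟩, ⟨h3, h4⟩, h5⟩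
    refine ⟨⟨?_, ?_⟩, ⟨?_, ?_⟩, by simpa using h5.int_sub s 1⟩ <;> simp only <;> linarith
  have h1 : ∀ y, F (F y) = y := by
    intro y
    obtain ⟨n, x, z, hz, rfl⟩ := M.surj y
    rw [h n x z hz, h _ _ _ (hd _ hz)]
    simp
  exact ⟨⟨⟨F, F, h1, h1⟩, hF, hF⟩, hm, h1, h⟩

/-- The rotation by `π` on horizontal lines. -/
lemma reflection_hline (hs : 2 ≤ s) {T : Y → Y}
    (hT : ∀ n x y, (x, y) ∈ Dom s b → T (M.q n x y) = M.q (-n) (s - x) (1 - y)) (n : G) {x y : ℝ}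
    (hy : y ∈ Set.Icc (0 : ℝ) 1) (h : Free b x y) :
    T (M.hline n x y) = M.hline (-n) (s - x) (1 - y) := by
  obtain ⟨x', j, rfl, h2, h3⟩ := M.hline_eq hs n hy h
  have hd : (s - x', 1 - y) ∈ Dom s b := by
    obtain ⟨⟨h1, h2⟩, ⟨h3, h4⟩, h5⟩ := h2
    refine ⟨⟨?_, ?_⟩, ⟨?_, ?_⟩, by simpa using h5.int_sub s 1⟩ <;> simp only at * <;> linarith
  rw [h3, hT _ _ _ h2, ← M.hline_of_mem hs _ hd, ← M.hline_add_period hs _ _ _ (-j)]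
  congr 1; push_cast; ring

/-- The rotation by `π` on vertical lines. -/
lemma reflection_vline (hc : ∀ k < s, c (perm s k) = - c k)
    (hc' : ∀ k < s, c (perm s (s - 1 - k)) = c k) {T : Y → Y}
    (hT : ∀ n x y, (x, y) ∈ Dom s b → T (M.q n x y) = M.q (-n) (s - x) (1 - y)) (n : G) {k : ℕ}
    (hk : k < s) {t y : ℝ} (ht : t ∈ Set.Icc (0 : ℝ) 1) (h : Free b t y) :
    T (M.vline n k t y) = M.vline (-n) (s - 1 - k) (1 - t) (1 - y) := by
  have key : ∀ n, ∀ l < s, ∀ y ∈ Set.Icc (0 : ℝ) 1, Free b t y →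
      T (M.q n (l + t) y) = M.vline (-n) (s - 1 - l) (1 - t) (1 - y) := by
    intro n l hl y hy h
    rw [hT _ _ _ (column_mem_dom hl ht hy h), M.vline_of_mem (-n) (by omega)
      ⟨by linarith [ht.2], by linarith [ht.1]⟩ ⟨by linarith [hy.2], by linarith [hy.1]⟩
      (by simpa using h.int_sub 1 1)]
    congr 1
    rw [Nat.cast_sub (by omega), Nat.cast_sub (by omega)]
    push_cast; ring
  obtain ⟨l, hl, y', hy', h', j, ⟨rfl, h1, rfl⟩ | ⟨rfl, h1, rfl⟩⟩ := M.vline_eq n hk h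
  · rw [h1, key n _ hl y' hy' h', ← M.vline_add_two _ _ _ _ (-j)]
    congr 1; push_cast; ring
  -- Here the point lies in the second rectangle of its line. Its image is one step away from the
  -- line in column `s - 1 - k`, whose coefficient is `- c k`; modulo the period 2, a step up and a
  -- step down agree.
  · have hr : s - 1 - k < s := by omega
    have e1 : c (s - 1 - k) = - c k := by
      have := hc _ hr
      rw [hc' k hk] at this
      rw [this, neg_neg]
    have e2 : perm s (s - 1 - k) = s - 1 - perm s k := by
      rw [← perm_reflect hk, perm_perm]
    rw [h1, key _ _ hl y' hy' h', neg_add, ← e1, ← e2, ← M.vline_sub_one hc _ hr,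
      ← M.vline_add_two _ _ _ _ (-j)]
    congr 1; push_cast; ring

end Model

/-! ### Commutation relations between lifts, deck transformations and the rotation -/

namespace Model

variable {s : ℕ} {G : Type} [AddCommGroup G] {c : ℕ → G} {b : Prop} {Y : Type}
  [TopologicalSpace Y] [MeasurableSpace Y] (M : Model s G c b Y)
  {G' : Type} [AddCommGroup G'] {c' : ℕ → G'} {b' : Prop} {Y' : Type}
  [TopologicalSpace Y'] [MeasurableSpace Y'] (M' : Model s G' c' b' Y')

/-- A map given by the identity of the rectangle respects horizontal lines. -/
lemma map_hline (hs : 2 ≤ s) {P : Y → Y'} {φ : G → G'}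
    (hP : ∀ n x y, (x, y) ∈ Dom s b → P (M.q n x y) = M'.q (φ n) x y) (n : G) {x y : ℝ}
    (hy : y ∈ Set.Icc (0 : ℝ) 1) (h : Free b x y) :
    P (M.hline n x y) = M'.hline (φ n) x y :=
  hP n _ _ (sub_floor_mem_dom hs hy h)

/-- A map given by the identity of the rectangle respects vertical lines. -/
lemma map_vline {P : Y → Y'} {φ : G → G'} (hφ : ∀ n k, φ (n + c k) = φ n + c' k)
    (hP : ∀ n x y, (x, y) ∈ Dom s b → P (M.q n x y) = M'.q (φ n) x y) (n : G) {k : ℕ}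
    (hk : k < s) {t y : ℝ} (ht : t ∈ Set.Icc (0 : ℝ) 1) (h : Free b t y) :
    P (M.vline n k t y) = M'.vline (φ n) k t y := by
  have h1 : Int.fract y ∈ Set.Icc (0 : ℝ) 1 := ⟨Int.fract_nonneg y, (Int.fract_lt_one y).le⟩
  have h2 : Free b t (Int.fract y) := by
    simpa [Int.fract, sub_eq_add_neg] using h.add_int 0 (-⌊y⌋)
  unfold vline
  split_ifs
  · exact hP n _ _ (column_mem_dom hk ht h1 h2)
  · rw [hP _ _ _ (column_mem_dom (perm_lt hk) ht h1 h2), hφ]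

variable {T T' J : Y → Y}

/-- A map that only changes labels intertwines the two twists, since these act on the coordinates
alone. With `P` the projection this says that one twist lifts the other, with `P` a deck
transformation it gives homogeneity. `vertical_comm` plays the same role. -/
lemma horizontal_comm (hs : 2 ≤ s) {P : Y → Y'} {φ : G → G'} {S : Y' → Y'} (hb : b' → b)
    (hP : ∀ n x y, (x, y) ∈ Dom s b → P (M.q n x y) = M'.q (φ n) x y)
    (hT : ∀ n x y, y ∈ Set.Icc (0 : ℝ) 1 → Free b x y →
      T (M.hline n x y) = M.hline n (x + s * y) y)
    (hS : ∀ n x y, y ∈ Set.Icc (0 : ℝ) 1 → Free b' x y →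
      S (M'.hline n x y) = M'.hline n (x + s * y) y) (y : Y) : P (T y) = S (P y) := by
  obtain ⟨n, x, z, hd, rfl⟩ := M.surj y
  have h := hd.2.2
  rw [← M.hline_of_mem hs n hd, hT n x z hd.2.1 h,
    M.map_hline M' hs hP n hd.2.1 (by simpa using h.horizontal_shear s),
    M.map_hline M' hs hP n hd.2.1 h, hS _ _ _ hd.2.1 (fun hb' => h (hb hb'))]

lemma vertical_comm (hs : 2 ≤ s) {P : Y → Y'} {φ : G → G'} {S : Y' → Y'} (hb : b' → b)
    (hφ : ∀ n k, φ (n + c k) = φ n + c' k)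
    (hP : ∀ n x y, (x, y) ∈ Dom s b → P (M.q n x y) = M'.q (φ n) x y)
    (hT : ∀ n, ∀ k < s, ∀ t ∈ Set.Icc (0 : ℝ) 1, ∀ y, Free b t y →
        T (M.vline n k t y) = M.vline n k t (y + 2 * t))
    (hS : ∀ n, ∀ k < s, ∀ t ∈ Set.Icc (0 : ℝ) 1, ∀ y, Free b' t y →
        S (M'.vline n k t y) = M'.vline n k t (y + 2 * t)) (y : Y) : P (T y) = S (P y) := by
  revert y
  refine M.column_induction hs fun n k hk t ht y hy h => ?_
  rw [← M.vline_of_mem n hk ht hy h, hT n k hk t ht y h,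
    M.map_vline M' hφ hP n hk ht (by simpa using h.vertical_shear 2),
    M.map_vline M' hφ hP n hk ht h, hS _ k hk t ht y (fun hb' => h (hb hb'))]

/-- The two abscissas are `s - (x + s * y)` and `(s - x) + s * (1 - y)`, which differ by one period
`s`. -/
lemma reflection_horizontal_comm (hs : 2 ≤ s)
    (hT : ∀ n x y, y ∈ Set.Icc (0 : ℝ) 1 → Free b x y →
      T (M.hline n x y) = M.hline n (x + s * y) y)
    (hJ : ∀ n x y, (x, y) ∈ Dom s b → J (M.q n x y) = M.q (-n) (s - x) (1 - y)) (y : Y) :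
    J (T y) = T (J y) := by
  obtain ⟨n, x, z, hd, rfl⟩ := M.surj y
  have h := hd.2.2
  have hz : 1 - z ∈ Set.Icc (0 : ℝ) 1 := ⟨by linarith [hd.2.1.2], by linarith [hd.2.1.1]⟩
  rw [← M.hline_of_mem hs n hd, hT n x z hd.2.1 h,
    M.reflection_hline hs hJ n hd.2.1 (by simpa using h.horizontal_shear s),
    M.reflection_hline hs hJ n hd.2.1 h, hT _ _ _ hz (by simpa using h.int_sub s 1),
    ← M.hline_add_period hs _ _ _ 1]
  congr 1; push_cast; ring

/-- The two heights are `1 - (y + 2 * t)` and `(1 - y) + 2 * (1 - t)`, which differ by one period 2.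
-/
lemma reflection_vertical_comm (hs : 2 ≤ s) (hc : ∀ k < s, c (perm s k) = - c k)
    (hc' : ∀ k < s, c (perm s (s - 1 - k)) = c k)
    (hT : ∀ n, ∀ k < s, ∀ t ∈ Set.Icc (0 : ℝ) 1, ∀ y, Free b t y →
        T (M.vline n k t y) = M.vline n k t (y + 2 * t))
    (hJ : ∀ n x y, (x, y) ∈ Dom s b → J (M.q n x y) = M.q (-n) (s - x) (1 - y)) (y : Y) :
    J (T y) = T (J y) := by
  revert y
  refine M.column_induction hs fun n k hk t ht y hy h => ?_
  rw [← M.vline_of_mem n hk ht hy h, hT n k hk t ht y h,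
    M.reflection_vline hc hc' hJ n hk ht (by simpa using h.vertical_shear 2),
    M.reflection_vline hc hc' hJ n hk ht h,
    hT _ _ (by omega) _ ⟨by linarith [ht.2], by linarith [ht.1]⟩ _ (by simpa using h.int_sub 1 1),
    ← M.vline_add_two _ _ _ _ 1]
  congr 1; push_cast; ring

end Model

/-! ### The surface and the cover -/

lemma dom_false (s : ℕ) {z : ℝ × ℝ} : z ∈ Dom s False ↔ z ∈ Rect s := by
  simp only [Dom, Rect, Free, Set.mem_ofPred_eq, Set.mem_prod, false_imp_iff, and_true]

lemma isVertex_iff {s : ℕ} {z : ℝ × ℝ} (hz : z ∈ Rect s) :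
    IsVertex z ↔ (∃ i : ℤ, z.1 = i) ∧ ∃ j : ℤ, z.2 = j := by
  obtain ⟨⟨h1, h2⟩, h3, h4⟩ := hz
  constructor
  · rintro ⟨⟨k, hk⟩, h⟩
    refine ⟨⟨k, by simp [hk]⟩, ?_⟩
    rcases h with h | h
    · exact ⟨0, by simp [h]⟩
    · exact ⟨1, by simp [h]⟩
  · rintro ⟨⟨i, hi⟩, j, hj⟩
    rw [hi] at h1
    rw [hj] at h3 h4
    have h1' : 0 ≤ i := by exact_mod_cast h1
    have h3' : 0 ≤ j := by exact_mod_cast h3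
    have h4' : j ≤ 1 := by exact_mod_cast h4
    refine ⟨⟨i.toNat, ?_⟩, ?_⟩
    · rw [hi]; exact_mod_cast (Int.toNat_of_nonneg h1').symm
    · rcases (by omega : j = 0 ∨ j = 1) with rfl | rfl
      · left; simp [hj]
      · right; simp [hj]

lemma dom_true (s : ℕ) {z : ℝ × ℝ} : z ∈ Dom s True ↔ z ∈ PRect s := by
  constructor
  · rintro ⟨h1, h2, h3⟩
    exact ⟨⟨h1, h2⟩, fun h => h3 trivial ((isVertex_iff (s := s) ⟨h1, h2⟩).1 h)⟩
  · rintro ⟨⟨h1, h2⟩, h3⟩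
    exact ⟨h1, h2, fun _ h => h3 ((isVertex_iff (s := s) ⟨h1, h2⟩).2 h)⟩

lemma measurableSet_rect (s : ℕ) : MeasurableSet (Rect s) :=
  measurableSet_Icc.prod measurableSet_Icc

lemma measurableSet_pRect (s : ℕ) : MeasurableSet (PRect s) := by
  refine (measurableSet_rect s).inter (MeasurableSet.compl ?_)
  have h1 : MeasurableSet {z : ℝ × ℝ | ∃ k : ℕ, z.1 = k} := by
    simp only [Set.ofPred_exists]
    exact MeasurableSet.iUnion fun k => measurableSet_eq_fun measurable_fst measurable_const
  exact h1.inter ((measurableSet_eq_fun measurable_snd measurable_const).union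
    (measurableSet_eq_fun measurable_snd measurable_const))

lemma measurable_surfaceMk (s : ℕ) : Measurable (Surface.mk (s := s)) := fun _ h => h

lemma measurable_coverMk (s : ℕ) :
    Measurable (fun a : ℤ × PRect s => Cover.mk a.1 a.2) := fun _ h => h

lemma continuous_surfaceMk (s : ℕ) : Continuous (Surface.mk (s := s)) := continuous_quot_mk

lemma continuous_coverMk (s : ℕ) :
    Continuous (fun a : ℤ × PRect s => Cover.mk a.1 a.2) := continuous_quot_mk

/-- The points of the surface, as a function of the coordinates. -/
def surfacePt (s : ℕ) (x y : ℝ) : Surface s :=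
  open Classical in
  if h : (x, y) ∈ Rect s then Surface.mk ⟨(x, y), h⟩
  else Surface.mk ⟨(0, 0), by simp [Rect]⟩

lemma surfacePt_of_mem {s : ℕ} {z : ℝ × ℝ} (h : z ∈ Rect s) :
    surfacePt s z.1 z.2 = Surface.mk ⟨z, h⟩ := dif_pos h

lemma half_mem_pRect {s : ℕ} (hs : 2 ≤ s) : ((1 / 2 : ℝ), (1 / 2 : ℝ)) ∈ PRect s := by
  have : (2 : ℝ) ≤ s := by exact_mod_cast hs
  refine ⟨⟨⟨by norm_num, ?_⟩, by norm_num⟩, ?_⟩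
  · simp only; linarith
  · rintro ⟨-, h⟩
    norm_num at h

/-- The points of the cover, as a function of the label and the coordinates. -/
def coverPt {s : ℕ} (hs : 2 ≤ s) (n : ℤ) (x y : ℝ) : Cover s :=
  open Classical in
  if h : (x, y) ∈ PRect s then Cover.mk n ⟨(x, y), h⟩
  -- Any constant value makes the function measurable on the whole plane. The corner `(0, 0)` is not
  -- available here, being a vertex.
  else Cover.mk 0 ⟨(1 / 2, 1 / 2), half_mem_pRect hs⟩

lemma coverPt_of_mem {s : ℕ} (hs : 2 ≤ s) (n : ℤ) {z : ℝ × ℝ} (h : z ∈ PRect s) :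
    coverPt hs n z.1 z.2 = Cover.mk n ⟨z, h⟩ := dif_pos h

/-- The surface as a glued rectangle. -/
def surfaceModel (s : ℕ) : Model s Unit (fun _ => 0) False (Surface s) where
  q _ := surfacePt s
  cont _ := by
    rw [continuousOn_iff_continuous_domRestrict]
    refine (continuous_surfaceMk s).comp (g := Surface.mk)
      (f := fun z : Dom s False => ⟨z.1, (dom_false s).1 z.2⟩) (by fun_prop) |>.congr fun z => ?_
    exact (surfacePt_of_mem ((dom_false s).1 z.2)).symm
  meas _ := by
    classical
    exact Measurable.dite (s := {z : ℝ × ℝ | z ∈ Rect s})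
      (f := fun z => Surface.mk z) (g := fun _ => _) (measurable_surfaceMk s)
      measurable_const (measurableSet_rect s)
  side _ y hy _ := by
    have h1 : ((0 : ℝ), y) ∈ Rect s := ⟨⟨le_rfl, by simp⟩, hy⟩
    have h2 : ((s : ℝ), y) ∈ Rect s := ⟨⟨by simp, le_rfl⟩, hy⟩
    refine (surfacePt_of_mem h1).trans (Eq.trans ?_ (surfacePt_of_mem h2).symm)
    exact Quot.sound (Or.inl ⟨rfl, rfl, rfl⟩)
  top _ k t hk ht _ := by
    have h1 : ((k : ℝ) + t, (1 : ℝ)) ∈ Rect s := ⟨column_mem hk ht, by simp⟩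
    have h2 : ((perm s k : ℝ) + t, (0 : ℝ)) ∈ Rect s := ⟨column_mem (perm_lt hk) ht, by simp⟩
    refine (surfacePt_of_mem h1).trans (Eq.trans ?_ (surfacePt_of_mem h2).symm)
    exact Quot.sound (Or.inr ⟨k, hk, t, ht, rfl, rfl⟩)
  surj y := by
    induction y using Quot.ind with
    | mk a => exact ⟨(), a.1.1, a.1.2, (dom_false s).2 a.2, surfacePt_of_mem a.2⟩
  lift f h1 h2 := by
    refine ⟨Quot.lift (fun a => f () a.1.1 a.1.2) ?_, fun n x y h => ?_⟩
    · rintro a b (⟨e1, e2, e3⟩ | ⟨k, hk, t, ht, e1, e2⟩)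
      · rw [e1, e2, ← e3]
        exact h1 () _ a.2.2 (fun h => h.elim)
      · simp only [e1, e2]
        exact h2 () k t hk ht (fun h => h.elim)
    · rw [surfacePt_of_mem ((dom_false s).1 h)]
      rfl
  cont_lift F hF := by
    refine isQuotientMap_quot_mk.continuous_iff.2 ?_
    refine ((continuousOn_iff_continuous_domRestrict.1 (hF ())).comp
      (f := fun a : Rect s => (⟨a.1, (dom_false s).2 a.2⟩ : Dom s False)) (by fun_prop)).congr ?_
    exact fun a => congrArg F (surfacePt_of_mem a.2)
  meas_lift F f hf h S hS := by
    have h1 : F ∘ Surface.mk = fun a : Rect s => f () a.1 := by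
      funext a
      rw [← h () a.1 ((dom_false s).2 a.2), surfacePt_of_mem a.2]
      rfl
    have h2 : Measurable (F ∘ Surface.mk) := h1 ▸ (hf ()).comp measurable_subtype_coe
    exact h2 hS

/-- The cover as glued copies of the rectangle without vertices. -/
def coverModel {s : ℕ} (hs : 2 ≤ s) : Model s ℤ (coverClass s) True (Cover s) where
  q := coverPt hs
  cont n := by
    rw [continuousOn_iff_continuous_domRestrict]
    refine (continuous_coverMk s).comp
      (f := fun z : Dom s True => (n, ⟨z.1, (dom_true s).1 z.2⟩)) (by fun_prop) |>.congr fun z => ?_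
    exact (coverPt_of_mem hs n ((dom_true s).1 z.2)).symm
  meas n := by
    classical
    exact Measurable.dite (s := {z : ℝ × ℝ | z ∈ PRect s})
      (f := fun z => Cover.mk n z) (g := fun _ => _)
      ((measurable_coverMk s).comp (measurable_const.prodMk measurable_id))
      measurable_const (measurableSet_pRect s)
  side n y hy h := by
    have h1 : ((0 : ℝ), y) ∈ PRect s := (dom_true s).1 ⟨⟨le_rfl, by simp⟩, hy, h⟩
    have h2 : ((s : ℝ), y) ∈ PRect s :=
      (dom_true s).1 ⟨⟨by simp, le_rfl⟩, hy, by simpa using h.add_int s 0⟩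
    refine (coverPt_of_mem hs n h1).trans (Eq.trans ?_ (coverPt_of_mem hs n h2).symm)
    exact Quot.sound (Or.inl ⟨rfl, rfl, rfl, rfl⟩)
  top n k t hk ht h := by
    have h1 : ((k : ℝ) + t, (1 : ℝ)) ∈ PRect s :=
      (dom_true s).1 (column_mem_dom hk ht (by simp) (by simpa using h.add_int 0 1))
    have h2 : ((perm s k : ℝ) + t, (0 : ℝ)) ∈ PRect s :=
      (dom_true s).1 (column_mem_dom (perm_lt hk) ht (by simp) h)
    refine (coverPt_of_mem hs n h1).trans (Eq.trans ?_ (coverPt_of_mem hs _ h2).symm)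
    refine Quot.sound (Or.inr ⟨k, hk, t, ⟨?_, ?_⟩, rfl, rfl, rfl⟩)
    -- The cover glues open edges only; the end points `t = 0` and `t = 1` are excluded because they
    -- would be vertices.
    · exact lt_of_le_of_ne ht.1 fun h0 => h trivial ⟨⟨0, by simp [← h0]⟩, 0, by simp⟩
    · exact lt_of_le_of_ne ht.2 fun h0 => h trivial ⟨⟨1, by simp [h0]⟩, 0, by simp⟩
  surj y := by
    induction y using Quot.ind with
    | mk a => exact ⟨a.1, a.2.1.1, a.2.1.2, (dom_true s).2 a.2.2, coverPt_of_mem hs a.1 a.2.2⟩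
  lift f h1 h2 := by
    refine ⟨Quot.lift (fun a => f a.1 a.2.1.1 a.2.1.2) ?_, fun n x y h => ?_⟩
    · rintro ⟨n, a, ha⟩ ⟨m, b, hb⟩ (⟨e1, e2, e3, e4⟩ | ⟨k, hk, t, ht, e1, e2, e3⟩)
      · have h := ((dom_true s).2 ha).2.2
        simp only at e1 e2 e3 e4
        rw [e1] at h
        simp only [e1, e2, ← e3, e4]
        exact h1 n _ ha.1.2 h
      · have h := ((dom_true s).2 hb).2.2
        simp only at e1 e2 e3
        rw [e2, free_column] at h
        simp only [e1, e2, e3]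
        exact h2 n k t hk (Set.Ioo_subset_Icc_self ht) h
    · rw [coverPt_of_mem hs n ((dom_true s).1 h)]
      rfl
  cont_lift F hF := by
    refine isQuotientMap_quot_mk.continuous_iff.2 ?_
    refine continuous_prod_of_discrete_left.2 fun n => ?_
    refine ((continuousOn_iff_continuous_domRestrict.1 (hF n)).comp
      (f := fun a : PRect s => (⟨a.1, (dom_true s).2 a.2⟩ : Dom s True)) (by fun_prop)).congr ?_
    exact fun a => congrArg F (coverPt_of_mem hs n a.2)
  meas_lift F f hf h S hS := by
    have h1 : (fun a : ℤ × PRect s => F (Cover.mk a.1 a.2)) = fun a => f a.1 a.2.1 := by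
      funext a
      rw [← h a.1 a.2.1 ((dom_true s).2 a.2.2), coverPt_of_mem hs a.1 a.2.2]
    have h2 : Measurable fun a : ℤ × PRect s => F (Cover.mk a.1 a.2) := by
      rw [h1]
      exact measurable_from_prod_countable_right fun n => (hf n).comp measurable_subtype_coe
    exact h2 hS

lemma proj_coverPt {s : ℕ} (hs : 2 ≤ s) (n : ℤ) (x y : ℝ) (h : (x, y) ∈ Dom s True) :
    proj s (coverPt hs n x y) = surfacePt s x y := by
  have h' := (dom_true s).1 h
  exact (congrArg _ (coverPt_of_mem hs n h')).trans (surfacePt_of_mem h'.1).symm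

lemma deck_coverPt {s : ℕ} (hs : 2 ≤ s) (m n : ℤ) (x y : ℝ) (h : (x, y) ∈ Dom s True) :
    deck s m (coverPt hs n x y) = coverPt hs (n + m) x y := by
  have h' := (dom_true s).1 h
  exact (congrArg _ (coverPt_of_mem hs n h')).trans (coverPt_of_mem hs (n + m) h').symm

/-- The vertical cylinder formed by the first and the last column crosses edges with coefficients
`-1` and `1`, so its core curve has degree zero and lifts to a closed curve. -/
lemma coverClass_perm {s : ℕ} (hs : 2 ≤ s) : ∀ k < s, coverClass s (perm s k) = - coverClass s k := by
  intro k hk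
  unfold coverClass perm
  simp only [Equiv.swap_apply_def]
  split_ifs <;> omega

/-- Both `k ↦ s - 1 - k` and `perm s` change the sign of the class, so their composition preserves
it. -/
lemma coverClass_reflect {s : ℕ} (hs : 2 ≤ s) :
    ∀ k < s, coverClass s (perm s (s - 1 - k)) = coverClass s k := by
  intro k hk
  unfold coverClass perm
  simp only [Equiv.swap_apply_def]
  split_ifs <;> omega

/-- The fibers of the projection. -/
lemma exists_label_of_proj_eq {s : ℕ} (hs : 2 ≤ s) {y : Cover s} {x z : ℝ}
    (hd : (x, z) ∈ Dom s False) (h : proj s y = surfacePt s x z) :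
    (x, z) ∈ Dom s True ∧ ∃ n, y = coverPt hs n x z := by
  -- The set of cover points with given coordinates is compatible with the gluing, so it descends to
  -- a set-valued function on the surface. This avoids any analysis of the equivalence relation
  -- generated by `Glue`.
  obtain ⟨F, hF⟩ := (surfaceModel s).lift
    (fun _ x z => {w : Cover s | (x, z) ∈ Dom s True ∧ ∃ n, w = coverPt hs n x z}) (by
      intro _ y hy _
      ext w
      constructor
      · rintro ⟨h1, n, rfl⟩
        have := h1.2.2
        exact ⟨⟨⟨by simp, le_rfl⟩, hy, by simpa using this.add_int s 0⟩, n,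
          (coverModel hs).side n y hy this⟩
      · rintro ⟨h1, n, rfl⟩
        have : Free True 0 y := by simpa using h1.2.2.add_int (-s) 0
        exact ⟨⟨⟨le_rfl, by simp⟩, hy, this⟩, n, ((coverModel hs).side n y hy this).symm⟩) (by
      intro _ k t hk ht _
      ext w
      constructor
      · rintro ⟨h1, n, rfl⟩
        have : Free True t 0 := by simpa using ((free_column k).1 h1.2.2).add_int 0 (-1)
        exact ⟨column_mem_dom (perm_lt hk) ht (by simp) this, _,
          (coverModel hs).top n k t hk ht this⟩
      · rintro ⟨h1, n, rfl⟩
        have : Free True t 0 := (free_column _).1 h1.2.2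
        refine ⟨column_mem_dom hk ht (by simp) (by simpa using this.add_int 0 1),
          n - coverClass s k, ?_⟩
        have h2 := (coverModel hs).top (n - coverClass s k) k t hk ht this
        rw [sub_add_cancel] at h2
        exact h2.symm)
  obtain ⟨n', x', z', hd', rfl⟩ := (coverModel hs).surj y
  have e1 := proj_coverPt hs n' x' z' hd'
  have d' : (x', z') ∈ Dom s False := ⟨hd'.1, hd'.2.1, fun h => h.elim⟩
  have e2 : coverPt hs n' x' z' ∈ F (surfacePt s x z) := by
    rw [← h]
    change _ ∈ F (proj s (coverPt hs n' x' z'))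
    rw [e1]
    exact (Set.ext_iff.1 (hF () x' z' d') _).2 ⟨hd', n', rfl⟩
  exact (Set.ext_iff.1 (hF () x z hd) _).1 e2

/-- The fibers of the projection are the orbits of the deck transformations. -/
lemma exists_deck_of_proj_eq {s : ℕ} (hs : 2 ≤ s) {y y' : Cover s} (h : proj s y = proj s y') :
    ∃ m, y' = deck s m y := by
  obtain ⟨n, x, z, hd, rfl⟩ := (coverModel hs).surj y
  have d1 : (x, z) ∈ Dom s False := ⟨hd.1, hd.2.1, fun h => h.elim⟩
  obtain ⟨-, m, rfl⟩ := exists_label_of_proj_eq hs d1 (h.symm.trans (proj_coverPt hs n x z hd))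
  refine ⟨m - n, ?_⟩
  have := deck_coverPt hs (m - n) n x z hd
  rw [add_sub_cancel] at this
  exact this.symm

/-! ### Derivatives -/

/-- The endomorphism of the torus given by an integral matrix. -/
def torusMap (A : Matrix (Fin 2) (Fin 2) ℤ) (u : Torus) : Torus :=
  (A 0 0 • u.1 + A 0 1 • u.2, A 1 0 • u.1 + A 1 1 • u.2)

lemma torusMap_coe (A : Matrix (Fin 2) (Fin 2) ℤ) (x y : ℝ) :
    torusMap A ((x : UnitAddCircle), (y : UnitAddCircle)) =
      (((A 0 0 * x + A 0 1 * y : ℝ) : UnitAddCircle), ((A 1 0 * x + A 1 1 * y : ℝ) : UnitAddCircle)) := by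
  simp only [torusMap, ← AddCircle.coe_zsmul, ← AddCircle.coe_add, zsmul_eq_mul]

/-- An integral matrix acts on the whole torus by a group endomorphism, so a global semiconjugacy
through `d` yields the local linear part at once. -/
lemma hasLinearPart_of_torusMap {Y : Type} [TopologicalSpace Y] {d : Y → Torus} (U : Set Y)
    {f : Y → Y} {A : Matrix (Fin 2) (Fin 2) ℤ} (h : ∀ y, d (f y) = torusMap A (d y)) :
    HasLinearPart d U f (A.map (↑)) := by
  refine fun p _ => ⟨1, one_pos, Eventually.of_forall fun q v _ hq => ?_⟩
  rw [h, h, hq]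
  have h1 : toTorus ((A.map (↑) : Matrix (Fin 2) (Fin 2) ℝ).mulVec v) = torusMap A (toTorus v) := by
    rw [toTorus, toTorus, torusMap_coe]
    simp [Matrix.mulVec, dotProduct, Fin.sum_univ_two]
  rw [h1]
  simp only [torusMap, Prod.fst_add, Prod.snd_add, smul_add, Prod.mk_add_mk]
  congr 1 <;> abel

lemma hasLinearPart_cover {s : ℕ} {Ψ : Cover s ≃ₜ Cover s} {ψ : Surface s ≃ₜ Surface s}
    (hΨ : IsLift Ψ ψ) {A : Matrix (Fin 2) (Fin 2) ℤ}
    (h : ∀ y, dev s (ψ y) = torusMap A (dev s y)) (U : Set (Cover s)) :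
    HasLinearPart (devCover s) U Ψ (A.map (↑)) := by
  refine hasLinearPart_of_torusMap U fun y => ?_
  rw [devCover, hΨ y, h]
  rfl

lemma dev_surfacePt {s : ℕ} {z : ℝ × ℝ} (h : z ∈ Dom s False) :
    dev s (surfacePt s z.1 z.2) = ((z.1 : UnitAddCircle), (z.2 : UnitAddCircle)) := by
  rw [surfacePt_of_mem ((dom_false s).1 h)]
  rfl

lemma coe_intCast_circle (n : ℤ) : ((n : ℝ) : UnitAddCircle) = 0 := by
  rw [AddCircle.coe_eq_zero_iff]
  exact ⟨n, by simp⟩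

lemma free_false (x y : ℝ) : Free False x y := fun h => h.elim

lemma dev_hline {s : ℕ} (hs : 2 ≤ s) (x : ℝ) {y : ℝ} (hy : y ∈ Set.Icc (0 : ℝ) 1) :
    dev s ((surfaceModel s).hline () x y) = ((x : UnitAddCircle), (y : UnitAddCircle)) := by
  refine (dev_surfacePt (sub_floor_mem_dom hs hy (free_false x y))).trans ?_
  have : x - s * ⌊x / s⌋ = x - ((s * ⌊x / s⌋ : ℤ) : ℝ) := by push_cast; rfl
  simp only [this, AddCircle.coe_sub, coe_intCast_circle, sub_zero]

/-- Every change of rectangle is a translation by an integer vector, invisible in the torus. -/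
lemma dev_vline {s k : ℕ} (hk : k < s) {t : ℝ} (ht : t ∈ Set.Icc (0 : ℝ) 1) (y : ℝ) :
    dev s ((surfaceModel s).vline () k t y) = ((t : UnitAddCircle), (y : UnitAddCircle)) := by
  obtain ⟨l, hl, y', hy', -, j, ⟨rfl, h1, rfl⟩ | ⟨rfl, h1, rfl⟩⟩ :=
    (surfaceModel s).vline_eq () hk (free_false t y)
  · rw [h1]
    refine (dev_surfacePt (column_mem_dom hl ht hy' (free_false _ _))).trans ?_
    have : y' + 2 * (j : ℝ) = y' + ((2 * j : ℤ) : ℝ) := by push_cast; rfl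
    simp only [this, AddCircle.coe_add, coe_intCast_circle, coe_natCast_circle, zero_add, add_zero]
  · rw [h1]
    refine (dev_surfacePt (column_mem_dom hl ht hy' (free_false _ _))).trans ?_
    have : y' + 1 + 2 * (j : ℝ) = y' + ((1 + 2 * j : ℤ) : ℝ) := by push_cast; ring
    simp only [this, AddCircle.coe_add, coe_intCast_circle, coe_natCast_circle, zero_add, add_zero]

lemma dev_horizontal {s : ℕ} (hs : 2 ≤ s) {T : Surface s → Surface s}
    (hT : ∀ n x y, y ∈ Set.Icc (0 : ℝ) 1 → Free False x y →
      T ((surfaceModel s).hline n x y) = (surfaceModel s).hline n (x + s * y) y) (p : Surface s) :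
    dev s (T p) = torusMap !![1, (s : ℤ); 0, 1] (dev s p) := by
  obtain ⟨n, x, z, hd, rfl⟩ := (surfaceModel s).surj p
  rw [← (surfaceModel s).hline_of_mem hs n hd, hT n x z hd.2.1 hd.2.2, dev_hline hs _ hd.2.1,
    dev_hline hs _ hd.2.1, torusMap_coe]
  simp

lemma dev_vertical {s : ℕ} (hs : 2 ≤ s) {T : Surface s → Surface s}
    (hT : ∀ n, ∀ k < s, ∀ t ∈ Set.Icc (0 : ℝ) 1, ∀ y, Free False t y →
        T ((surfaceModel s).vline n k t y) = (surfaceModel s).vline n k t (y + 2 * t))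
    (p : Surface s) :
    dev s (T p) = torusMap !![1, 0; 2, 1] (dev s p) := by
  revert p
  refine (surfaceModel s).column_induction hs fun n k hk t ht y hy h => ?_
  rw [← (surfaceModel s).vline_of_mem n hk ht hy h, hT n k hk t ht y h, dev_vline hk ht,
    dev_vline hk ht, torusMap_coe]
  simp [add_comm]

lemma dev_reflection {s : ℕ} {T : Surface s → Surface s}
    (hT : ∀ n x y, (x, y) ∈ Dom s False →
      T ((surfaceModel s).q n x y) = (surfaceModel s).q (-n) (s - x) (1 - y)) (p : Surface s) :
    dev s (T p) = torusMap (-1) (dev s p) := by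
  obtain ⟨n, x, z, hd, rfl⟩ := (surfaceModel s).surj p
  have hd' : ((s : ℝ) - x, 1 - z) ∈ Dom s False :=
    ⟨⟨by linarith [hd.1.2], by linarith [hd.1.1]⟩, ⟨by linarith [hd.2.1.2], by linarith [hd.2.1.1]⟩,
      free_false _ _⟩
  rw [hT n x z hd]
  refine (dev_surfacePt hd').trans ?_
  refine Eq.trans ?_ (congrArg _ (dev_surfacePt hd).symm)
  have h1 : ((1 : ℝ) : UnitAddCircle) = 0 := by simp
  rw [torusMap_coe]
  simp [coe_natCast_circle, h1]

/-! ### Marked points -/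

lemma mem_marked_iff {s : ℕ} {p : Surface s} : p ∈ marked s ↔
    ∃ x y, (x, y) ∈ Dom s False ∧ IsVertex (x, y) ∧ surfacePt s x y = p := by
  constructor
  · rintro ⟨a, ha, rfl⟩
    exact ⟨a.1.1, a.1.2, (dom_false s).2 a.2, ha, surfacePt_of_mem a.2⟩
  · rintro ⟨x, y, hd, hv, rfl⟩
    exact ⟨⟨(x, y), (dom_false s).1 hd⟩, hv, (surfacePt_of_mem ((dom_false s).1 hd)).symm⟩

lemma horizontal_fix {s : ℕ} (hs : 2 ≤ s) {T : Surface s → Surface s}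
    (hT : ∀ n x y, y ∈ Set.Icc (0 : ℝ) 1 → Free False x y →
      T ((surfaceModel s).hline n x y) = (surfaceModel s).hline n (x + s * y) y) {x y : ℝ}
    (hd : (x, y) ∈ Dom s False) (hy : y = 0 ∨ y = 1) :
    T (surfacePt s x y) = surfacePt s x y := by
  have h1 := (surfaceModel s).hline_of_mem hs () hd
  change _ = surfacePt s x y at h1
  rw [← h1, hT () x y hd.2.1 hd.2.2]
  rcases hy with rfl | rfl
  · simp
  · rw [← (surfaceModel s).hline_add_period hs () x 1 1]
    simp

lemma vertical_fix {s : ℕ} (hs : 2 ≤ s) {T : Surface s → Surface s}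
    (hT : ∀ n, ∀ k < s, ∀ t ∈ Set.Icc (0 : ℝ) 1, ∀ y, Free False t y →
        T ((surfaceModel s).vline n k t y) = (surfaceModel s).vline n k t (y + 2 * t))
    {x y : ℝ} (hd : (x, y) ∈ Dom s False) (hx : ∃ k : ℕ, x = k) :
    T (surfacePt s x y) = surfacePt s x y := by
  obtain ⟨k, hk, t, ht, rfl⟩ := exists_column hs hd.1
  -- An integral `t` makes the shift `2 * t` a multiple of the period 2.
  have ht' : ∃ j : ℤ, t = j := by
    obtain ⟨l, hl⟩ := hx
    exact ⟨l - k, by push_cast; linarith⟩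
  obtain ⟨j, hj⟩ := ht'
  have h1 := (surfaceModel s).vline_of_mem () hk ht hd.2.1 (free_false t y)
  change _ = surfacePt s (k + t) y at h1
  rw [← h1, hT () k hk t ht y (free_false _ _)]
  conv_lhs => rw [hj, ← hj]
  rw [← (surfaceModel s).vline_add_two () k t y j, ← hj]

lemma image_marked_of_fix {s : ℕ} {T : Surface s ≃ₜ Surface s}
    (h : ∀ x y, (x, y) ∈ Dom s False → IsVertex (x, y) → T (surfacePt s x y) = surfacePt s x y) :
    T '' marked s = marked s := by
  have h1 : ∀ p ∈ marked s, T p = p := by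
    intro p hp
    obtain ⟨x, y, hd, hv, rfl⟩ := mem_marked_iff.1 hp
    exact h x y hd hv
  ext p
  constructor
  · rintro ⟨p, hp, rfl⟩
    rwa [h1 p hp]
  · exact fun hp => ⟨p, hp, h1 p hp⟩

lemma image_marked_of_reflection {s : ℕ} {T : Surface s ≃ₜ Surface s} (hTT : ∀ p, T (T p) = p)
    (hT : ∀ n x y, (x, y) ∈ Dom s False →
      T ((surfaceModel s).q n x y) = (surfaceModel s).q (-n) (s - x) (1 - y)) :
    T '' marked s = marked s := by
  have h1 : ∀ p ∈ marked s, T p ∈ marked s := by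
    intro p hp
    obtain ⟨x, y, hd, hv, rfl⟩ := mem_marked_iff.1 hp
    have hd' : ((s : ℝ) - x, 1 - y) ∈ Dom s False :=
      ⟨⟨by linarith [hd.1.2], by linarith [hd.1.1]⟩,
        ⟨by linarith [hd.2.1.2], by linarith [hd.2.1.1]⟩, free_false _ _⟩
    refine mem_marked_iff.2 ⟨_, _, hd', ?_, (hT () x y hd).symm⟩
    obtain ⟨⟨i, hi⟩, j, hj⟩ := (isVertex_iff ((dom_false s).1 hd)).1 hv
    refine (isVertex_iff ((dom_false s).1 hd')).2 ⟨⟨s - i, ?_⟩, 1 - j, ?_⟩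
    · simp only at hi ⊢; rw [hi]; push_cast; ring
    · simp only at hj ⊢; rw [hj]; push_cast; ring
  ext p
  constructor
  · rintro ⟨p, hp, rfl⟩
    exact h1 p hp
  · exact fun hp => ⟨T p, h1 p hp, hTT p⟩

/-! ### Invariance of the Lebesgue measure -/

lemma integrable_of_bounded {α : Type*} [MeasurableSpace α] {μ : Measure α} [IsFiniteMeasure μ]
    {f : α → ℝ} (hf : Measurable f) {C : ℝ} (hC : ∀ x, |f x| ≤ C) : Integrable f μ :=
  Integrable.of_bound hf.aestronglyMeasurable C (Eventually.of_forall hC)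

lemma intervalIntegrable_of_bounded {f : ℝ → ℝ} (hf : Measurable f) {C : ℝ}
    (hC : ∀ x, |f x| ≤ C) (a b : ℝ) : IntervalIntegrable f volume a b := by
  rw [intervalIntegrable_iff]
  have : IsFiniteMeasure (volume.restrict (Set.uIoc a b)) :=
    ⟨by simp [Set.uIoc]⟩
  exact integrable_of_bounded hf hC

lemma intervalIntegrable_integral {G : ℝ × ℝ → ℝ} (hG : Measurable G) {C : ℝ}
    (hC : ∀ z, |G z| ≤ C) (a b : ℝ) :
    IntervalIntegrable (fun t => ∫ y in (0 : ℝ)..1, G (t, y)) volume a b := by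
  refine intervalIntegrable_of_bounded (C := C) ?_ (fun t => ?_) a b
  · simp_rw [intervalIntegral.integral_of_le zero_le_one]
    exact hG.stronglyMeasurable.integral_prod_right'.measurable
  · have := intervalIntegral.norm_integral_le_of_norm_le_const (a := (0 : ℝ)) (b := 1)
      (f := fun y => G (t, y)) (C := C) (fun y _ => hC _)
    simpa using this

lemma lebesgue_finite (s : ℕ) (hs : 2 ≤ s) : IsFiniteMeasure (lebesgue s) := by
  have h1 : IsFiniteMeasure (Measure.comap ((↑) : Rect s → ℝ × ℝ) (volume : Measure (ℝ × ℝ))) := by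
    refine ⟨?_⟩
    rw [comap_subtype_coe_apply (measurableSet_rect s)]
    have : IsCompact (Rect s) := isCompact_Icc.prod isCompact_Icc
    simpa using this.measure_lt_top
  have h2 : (s : ℝ≥0∞)⁻¹ ≠ ∞ := by
    simp; omega
  unfold lebesgue
  exact Measure.smul_finite _ h2

/-- The Lebesgue integral on the surface. -/
lemma integral_lebesgue {s : ℕ} {g : Surface s → ℝ} (hg : Measurable g) :
    ∫ p, g p ∂(lebesgue s) = (s : ℝ)⁻¹ * ∫ z in Rect s, g (surfacePt s z.1 z.2) := by
  unfold lebesgue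
  rw [integral_smul_measure, integral_map (measurable_surfaceMk s).aemeasurable
    hg.aestronglyMeasurable, ← integral_subtype_comap (measurableSet_rect s)]
  simp only [ENNReal.toReal_inv, ENNReal.toReal_natCast, smul_eq_mul]
  congr 2
  funext a
  rw [surfacePt_of_mem a.2]

lemma measurable_comp_surfacePt {s : ℕ} {g : Surface s → ℝ} (hg : Measurable g) :
    Measurable (fun z : ℝ × ℝ => g (surfacePt s z.1 z.2)) :=
  hg.comp ((surfaceModel s).meas ())

lemma integrableOn_rect {s : ℕ} {G : ℝ × ℝ → ℝ} (hG : Measurable G) {C : ℝ}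
    (hC : ∀ z, |G z| ≤ C) : IntegrableOn G (Rect s) := by
  have : IsFiniteMeasure (volume.restrict (Rect s)) := by
    have : IsCompact (Rect s) := isCompact_Icc.prod isCompact_Icc
    exact ⟨by simpa using this.measure_lt_top⟩
  exact integrable_of_bounded hG hC

/-- Integration over vertical lines first. -/
lemma integral_rect {s : ℕ} {G : ℝ × ℝ → ℝ} (hG : Measurable G) {C : ℝ} (hC : ∀ z, |G z| ≤ C) :
    ∫ z in Rect s, G z = ∫ x in (0 : ℝ)..s, ∫ y in (0 : ℝ)..1, G (x, y) := by
  have h := integrableOn_rect (s := s) hG hC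
  unfold Rect at h ⊢
  rw [Measure.volume_eq_prod] at h ⊢
  rw [setIntegral_prod _ h, intervalIntegral.integral_of_le (Nat.cast_nonneg s),
    ← integral_Icc_eq_integral_Ioc]
  simp_rw [intervalIntegral.integral_of_le zero_le_one, ← integral_Icc_eq_integral_Ioc]

/-- Integration over horizontal lines first. -/
lemma integral_rect_symm {s : ℕ} {G : ℝ × ℝ → ℝ} (hG : Measurable G) {C : ℝ}
    (hC : ∀ z, |G z| ≤ C) :
    ∫ z in Rect s, G z = ∫ y in (0 : ℝ)..1, ∫ x in (0 : ℝ)..s, G (x, y) := by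
  rw [integral_rect hG hC]
  refine intervalIntegral_intervalIntegral_swap ?_
  rw [Set.uIoc_of_le (Nat.cast_nonneg s), Set.uIoc_of_le zero_le_one]
  refine (integrableOn_rect (s := s) hG hC).mono_set ?_
  exact Set.prod_mono Set.Ioc_subset_Icc_self Set.Ioc_subset_Icc_self

/-- Integration over the columns. -/
lemma integral_rect_columns {s : ℕ} {G : ℝ × ℝ → ℝ} (hG : Measurable G) {C : ℝ}
    (hC : ∀ z, |G z| ≤ C) :
    ∫ z in Rect s, G z =
      ∑ k ∈ Finset.range s, ∫ t in (0 : ℝ)..1, ∫ y in (0 : ℝ)..1, G (k + t, y) := by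
  have h := intervalIntegral.sum_integral_adjacent_intervals (a := fun k : ℕ => (k : ℝ)) (n := s)
    (f := fun x => ∫ y in (0 : ℝ)..1, G (x, y)) (μ := volume)
    (fun k _ => intervalIntegrable_integral hG hC _ _)
  rw [integral_rect hG hC]
  simp only [Nat.cast_zero] at h
  rw [← h]
  refine Finset.sum_congr rfl fun k _ => ?_
  rw [intervalIntegral.integral_comp_add_left (fun x => ∫ y in (0 : ℝ)..1, G (x, y))]
  simp

/-- The map `f` preserves the integrals of bounded measurable functions. -/
def PreservesIntegrals {s : ℕ} (f : Surface s → Surface s) : Prop :=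
  ∀ g : Surface s → ℝ, Measurable g → (∃ C, ∀ p, |g p| ≤ C) →
    ∫ p, g (f p) ∂(lebesgue s) = ∫ p, g p ∂(lebesgue s)

lemma PreservesIntegrals.comp {s : ℕ} {f f' : Surface s → Surface s} (hf : PreservesIntegrals f)
    (hf' : PreservesIntegrals f') (hm : Measurable f) : PreservesIntegrals fun p => f (f' p) := by
  rintro g hg ⟨C, hC⟩
  rw [hf' (fun p => g (f p)) (hg.comp hm) ⟨C, fun p => hC _⟩, hf g hg ⟨C, hC⟩]

/-- By Fubini the inner integral runs over a closed horizontal line, that is, over one period of a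
periodic function, and the twist translates its argument. -/
lemma preservesIntegrals_horizontal {s : ℕ} (hs : 2 ≤ s) {T : Surface s → Surface s}
    (hm : Measurable T)
    (hT : ∀ n x y, y ∈ Set.Icc (0 : ℝ) 1 → Free False x y →
      T ((surfaceModel s).hline n x y) = (surfaceModel s).hline n (x + s * y) y) :
    PreservesIntegrals T := by
  rintro g hg ⟨C, hC⟩
  have hgT : Measurable fun p => g (T p) := hg.comp hm
  rw [integral_lebesgue hg, integral_lebesgue hgT]
  congr 1
  rw [integral_rect_symm (measurable_comp_surfacePt hgT) (fun z => hC _),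
    integral_rect_symm (measurable_comp_surfacePt hg) (fun z => hC _)]
  refine intervalIntegral.integral_congr fun y hy => ?_
  rw [Set.uIcc_of_le zero_le_one] at hy
  set φ : ℝ → ℝ := fun x => g ((surfaceModel s).hline () x y) with hφ
  have hper : Function.Periodic φ s := fun x => by
    have := (surfaceModel s).hline_add_period hs () x y 1
    simp only [Int.cast_one, mul_one] at this
    simp only [hφ, this]
  have h1 : ∀ x ∈ Set.uIcc (0 : ℝ) s,
      surfacePt s x y = (surfaceModel s).hline () x y := fun x hx => by
    rw [Set.uIcc_of_le (Nat.cast_nonneg s)] at hx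
    exact ((surfaceModel s).hline_of_mem hs () ⟨hx, hy, free_false _ _⟩).symm
  calc ∫ x in (0 : ℝ)..s, g (T (surfacePt s x y))
      = ∫ x in (0 : ℝ)..s, φ (x + s * y) := by
        refine intervalIntegral.integral_congr fun x hx => ?_
        simp only [hφ]
        rw [h1 x hx, hT () x y hy (free_false _ _)]
    _ = ∫ x in (0 : ℝ)..s, φ x := by
        rw [intervalIntegral.integral_comp_add_right φ]
        have := hper.intervalIntegral_add_eq (s * y) 0
        rw [zero_add] at this
        rw [zero_add, ← this, add_comm]
    _ = _ := by
        refine intervalIntegral.integral_congr fun x hx => ?_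
        simp only [hφ]
        rw [h1 x hx]

lemma sum_perm {s : ℕ} (f : ℕ → ℝ) :
    ∑ k ∈ Finset.range s, f (perm s k) = ∑ k ∈ Finset.range s, f k := by
  refine Finset.sum_equiv (perm s) (fun k => ?_) (fun k _ => rfl)
  simp only [Finset.mem_range]
  refine ⟨perm_lt, fun h => ?_⟩
  simpa [perm_perm] using perm_lt h

lemma preservesIntegrals_vertical {s : ℕ} {T : Surface s → Surface s}
    (hm : Measurable T)
    (hT : ∀ n, ∀ k < s, ∀ t ∈ Set.Icc (0 : ℝ) 1, ∀ y, Free False t y →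
        T ((surfaceModel s).vline n k t y) = (surfaceModel s).vline n k t (y + 2 * t)) :
    PreservesIntegrals T := by
  rintro g hg ⟨C, hC⟩
  set G : ℕ → ℝ × ℝ → ℝ := fun k z => g ((surfaceModel s).vline () k z.1 z.2) with hGdef
  have hG : ∀ k, Measurable (G k) := fun k => hg.comp ((surfaceModel s).measurable_vline () k)
  have hG' : ∀ k, Measurable fun z : ℝ × ℝ => G k (z.1, z.2 + 2 * z.1) := fun k =>
    (hG k).comp (by fun_prop)
  have hsec : ∀ k t, Measurable fun y => G k (t, y) := fun k t => (hG k).comp (by fun_prop)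
  have hshift : ∀ k < s, ∀ t y, G k (t, y + 1) = G (perm s k) (t, y) := fun k hk t y =>
    congrArg g ((surfaceModel s).vline_add_one (by simp) () hk t y)
  have hper : ∀ k t, Function.Periodic (fun y => G k (t, y)) 2 := fun k t y => by
    have := (surfaceModel s).vline_add_two () k t y 1
    simp only [Int.cast_one, mul_one] at this
    simp only [hGdef, this]
  -- A single column need not be preserved, but columns `k` and `perm s k` together make up a full
  -- period 2 of the vertical line, over which a translation does not change the integral.
  have key : ∀ k < s, ∀ t : ℝ,
      (∫ y in (0 : ℝ)..1, G k (t, y + 2 * t)) + ∫ y in (0 : ℝ)..1, G (perm s k) (t, y + 2 * t) =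
      (∫ y in (0 : ℝ)..1, G k (t, y)) + ∫ y in (0 : ℝ)..1, G (perm s k) (t, y) := by
    have aux : ∀ k < s, ∀ t r : ℝ,
        (∫ y in (0 : ℝ)..1, G k (t, y + r)) + ∫ y in (0 : ℝ)..1, G (perm s k) (t, y + r) =
        ∫ y in (0 : ℝ)..2, G k (t, y) := by
      intro k hk t r
      have h1 : ∀ y, G (perm s k) (t, y + r) = G k (t, y + (1 + r)) := fun y => by
        rw [← hshift k hk]; congr 2; ring
      simp_rw [h1]
      rw [intervalIntegral.integral_comp_add_right (fun y => G k (t, y)),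
        intervalIntegral.integral_comp_add_right (fun y => G k (t, y))]
      have h2 := (hper k t).intervalIntegral_add_eq r 0
      rw [zero_add] at h2
      rw [← h2, zero_add, zero_add, show (1 : ℝ) + (1 + r) = r + 2 by ring,
        intervalIntegral.integral_add_adjacent_intervals]
      · exact intervalIntegrable_of_bounded (hsec k t) (fun y => hC _) _ _
      · exact intervalIntegrable_of_bounded (hsec k t) (fun y => hC _) _ _
    intro k hk t
    rw [aux k hk t]
    simpa using (aux k hk t 0).symm
  have hA : ∀ k, IntervalIntegrable (fun t => ∫ y in (0 : ℝ)..1, G k (t, y)) volume 0 1 :=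
    fun k => intervalIntegrable_integral (hG k) (fun z => hC _) _ _
  have hB : ∀ k, IntervalIntegrable (fun t => ∫ y in (0 : ℝ)..1, G k (t, y + 2 * t)) volume 0 1 :=
    fun k => intervalIntegrable_integral (hG' k) (fun z => hC _) _ _
  have hgT : Measurable fun p => g (T p) := hg.comp hm
  rw [integral_lebesgue hg, integral_lebesgue hgT]
  congr 1
  rw [integral_rect_columns (measurable_comp_surfacePt hgT) (fun z => hC _),
    integral_rect_columns (measurable_comp_surfacePt hg) (fun z => hC _)]
  have hL : ∀ k ∈ Finset.range s,
      ∫ t in (0 : ℝ)..1, ∫ y in (0 : ℝ)..1, g (T (surfacePt s (k + t) y)) =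
      ∫ t in (0 : ℝ)..1, ∫ y in (0 : ℝ)..1, G k (t, y + 2 * t) := by
    intro k hk
    refine intervalIntegral.integral_congr fun t ht => intervalIntegral.integral_congr fun y hy => ?_
    rw [Set.uIcc_of_le zero_le_one] at ht hy
    have hk' := Finset.mem_range.1 hk
    simp only [hGdef]
    rw [← hT () k hk' t ht y (free_false _ _),
      (surfaceModel s).vline_of_mem () hk' ht hy (free_false _ _)]
    rfl
  have hR : ∀ k ∈ Finset.range s,
      ∫ t in (0 : ℝ)..1, ∫ y in (0 : ℝ)..1, g (surfacePt s (k + t) y) =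
      ∫ t in (0 : ℝ)..1, ∫ y in (0 : ℝ)..1, G k (t, y) := by
    intro k hk
    refine intervalIntegral.integral_congr fun t ht => intervalIntegral.integral_congr fun y hy => ?_
    rw [Set.uIcc_of_le zero_le_one] at ht hy
    simp only [hGdef]
    rw [(surfaceModel s).vline_of_mem () (Finset.mem_range.1 hk) ht hy (free_false _ _)]
    rfl
  refine (Finset.sum_congr rfl hL).trans (Eq.trans ?_ (Finset.sum_congr rfl hR).symm)
  -- Summing over all `k` counts every column twice, once as `k` and once as `perm s k`; this also
  -- covers the columns fixed by `perm s`.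
  have h2 : ∀ k ∈ Finset.range s,
      (∫ t in (0 : ℝ)..1, ∫ y in (0 : ℝ)..1, G k (t, y + 2 * t)) +
        (∫ t in (0 : ℝ)..1, ∫ y in (0 : ℝ)..1, G (perm s k) (t, y + 2 * t)) =
      (∫ t in (0 : ℝ)..1, ∫ y in (0 : ℝ)..1, G k (t, y)) +
        (∫ t in (0 : ℝ)..1, ∫ y in (0 : ℝ)..1, G (perm s k) (t, y)) := by
    intro k hk
    rw [← intervalIntegral.integral_add (hB _) (hB _), ← intervalIntegral.integral_add (hA _) (hA _)]
    exact intervalIntegral.integral_congr fun t _ => key k (Finset.mem_range.1 hk) t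
  have h3 := Finset.sum_congr rfl h2
  rw [Finset.sum_add_distrib, Finset.sum_add_distrib,
    sum_perm (fun k => ∫ t in (0 : ℝ)..1, ∫ y in (0 : ℝ)..1, G k (t, y + 2 * t)),
    sum_perm (fun k => ∫ t in (0 : ℝ)..1, ∫ y in (0 : ℝ)..1, G k (t, y))] at h3
  linarith

lemma preservesIntegrals_reflection {s : ℕ} {T : Surface s → Surface s} (hm : Measurable T)
    (hT : ∀ n x y, (x, y) ∈ Dom s False →
      T ((surfaceModel s).q n x y) = (surfaceModel s).q (-n) (s - x) (1 - y)) :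
    PreservesIntegrals T := by
  rintro g hg ⟨C, hC⟩
  have hgT : Measurable fun p => g (T p) := hg.comp hm
  rw [integral_lebesgue hg, integral_lebesgue hgT]
  congr 1
  rw [integral_rect (measurable_comp_surfacePt hgT) (fun z => hC _),
    integral_rect (measurable_comp_surfacePt hg) (fun z => hC _)]
  calc ∫ x in (0 : ℝ)..s, ∫ y in (0 : ℝ)..1, g (T (surfacePt s x y))
      = ∫ x in (0 : ℝ)..s, ∫ y in (0 : ℝ)..1, g (surfacePt s (s - x) (1 - y)) := by
        refine intervalIntegral.integral_congr fun x hx =>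
          intervalIntegral.integral_congr fun y hy => ?_
        rw [Set.uIcc_of_le zero_le_one] at hy
        rw [Set.uIcc_of_le (Nat.cast_nonneg s)] at hx
        exact congrArg g (hT () x y ⟨hx, hy, free_false _ _⟩)
    _ = ∫ x in (0 : ℝ)..s, ∫ y in (0 : ℝ)..1, g (surfacePt s (s - x) y) := by
        refine intervalIntegral.integral_congr fun x _ => ?_
        rw [intervalIntegral.integral_comp_sub_left (fun y => g (surfacePt s (s - x) y))]
        simp
    _ = _ := by
        rw [intervalIntegral.integral_comp_sub_left
          (fun x => ∫ y in (0 : ℝ)..1, g (surfacePt s x y))]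
        simp

/-! ### Average drift -/

/-- The function on the surface induced by a deck-invariant function on the cover. -/
def descend {s : ℕ} (g : Cover s → ℤ) (p : Surface s) : ℤ :=
  open Classical in if h : ∃ y, proj s y = p then g h.choose else 0

lemma descend_proj {s : ℕ} (hs : 2 ≤ s) {g : Cover s → ℤ} (hg : ∀ m y, g (deck s m y) = g y)
    (y : Cover s) : descend g (proj s y) = g y := by
  have h : ∃ y', proj s y' = proj s y := ⟨y, rfl⟩
  obtain ⟨m, hm⟩ := exists_deck_of_proj_eq hs h.choose_spec
  have h2 := hg m h.choose
  rw [← hm] at h2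
  exact (dif_pos h).trans h2.symm

lemma descend_of_forall_ne {s : ℕ} (g : Cover s → ℤ) {p : Surface s} (h : ∀ y, proj s y ≠ p) :
    descend g p = 0 :=
  dif_neg (by simpa using h)

/-- In coordinates the function is `g` on the copy with label 0 away from the vertices, and 0 at the
vertices, which have no preimage. -/
lemma measurable_descend {s : ℕ} (hs : 2 ≤ s) {g : Cover s → ℤ} (hm : Measurable g)
    (hg : ∀ m y, g (deck s m y) = g y) : Measurable (descend g) := by
  classical
  refine (surfaceModel s).meas_lift _
    (fun _ z => if z ∈ PRect s then g (coverPt hs 0 z.1 z.2) else 0)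
    (fun _ => Measurable.ite (measurableSet_pRect s) (hm.comp ((coverModel hs).meas 0))
      measurable_const) ?_
  rintro n z hz
  change descend g (surfacePt s z.1 z.2) = _
  split_ifs with h
  · rw [← proj_coverPt hs 0 z.1 z.2 ((dom_true s).2 h), descend_proj hs hg]
  · exact descend_of_forall_ne g fun y hy =>
      h ((dom_true s).1 (exists_label_of_proj_eq hs hz hy).1)

lemma descend_bounded {s : ℕ} (hs : 2 ≤ s) {g : Cover s → ℤ} (hg : ∀ m y, g (deck s m y) = g y)
    {C : ℤ} (hC : ∀ y, |g y| ≤ C) (p : Surface s) : |(descend g p : ℝ)| ≤ C := by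
  by_cases h : ∃ y, proj s y = p
  · obtain ⟨y, rfl⟩ := h
    rw [descend_proj hs hg]
    exact_mod_cast hC y
  · rw [descend_of_forall_ne g (by simpa using h)]
    -- Any point of the cover will do: it only serves to show `0 ≤ C`.
    have := (abs_nonneg _).trans (hC (coverPt hs 0 0 0))
    simpa using this

/-- There is a coordinate close to the label of the copies of the rectangle. -/
lemma exists_coordinate {s : ℕ} (hs : 2 ≤ s) : ∃ ξ : Cover s → ℤ, IsCoordinate ξ ∧
    ∀ n x y, (x, y) ∈ Dom s True → |ξ (coverPt hs n x y) - n| ≤ 1 := by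
  -- The bare label is ambiguous on horizontal edges. Points of the top side get the label of the
  -- copy above, to whose bottom side they are glued.
  set f : ℤ → ℝ → ℝ → ℤ := fun n x y => if y = 1 then n + coverClass s ⌊x⌋₊ else n with hf
  obtain ⟨ξ, hξ⟩ := (coverModel hs).lift f (by
      intro n y hy h
      have h1 : y ≠ 1 := fun h1 => h trivial ⟨⟨0, by simp⟩, 1, by simp [h1]⟩
      simp [hf, h1]) (by
      intro n k t hk ht h
      have h1 : t ≠ 1 := fun h1 => h trivial ⟨⟨1, by simp [h1]⟩, 0, by simp⟩
      have h2 : ⌊(k : ℝ) + t⌋₊ = k := by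
        rw [Nat.floor_eq_iff (by linarith [ht.1, (Nat.cast_nonneg k : (0 : ℝ) ≤ k)])]
        exact ⟨by linarith [ht.1], by linarith [lt_of_le_of_ne ht.2 h1]⟩
      simp [hf, h2])
  have hb : ∀ n x y, (x, y) ∈ Dom s True → |ξ (coverPt hs n x y) - n| ≤ 1 := by
    intro n x y hd
    have h1 : ξ (coverPt hs n x y) = f n x y := hξ n x y hd
    have h2 : |coverClass s ⌊x⌋₊| ≤ 1 := by
      unfold coverClass
      split_ifs <;> simp
    rw [h1]
    simp only [hf]
    split_ifs
    · simpa using h2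
    · simp
  have hdeck : ∀ m y, ξ (deck s m y) = ξ y + m := by
    intro m y
    obtain ⟨n, x, z, hd, rfl⟩ := (coverModel hs).surj y
    have h1 : deck s m ((coverModel hs).q n x z) = (coverModel hs).q (n + m) x z :=
      deck_coverPt hs m n x z hd
    rw [h1, hξ _ _ _ hd, hξ _ _ _ hd]
    simp only [hf]
    split_ifs <;> ring
  refine ⟨ξ, ⟨?_, hdeck, 1, fun y hy => ?_⟩, hb⟩
  · refine (coverModel hs).meas_lift ξ (fun n z => f n z.1 z.2) (fun n => ?_)
      (fun n z hz => hξ n _ _ hz)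
    refine Measurable.ite (measurableSet_eq_fun measurable_snd measurable_const) ?_
      measurable_const
    have h1 : Measurable fun j : ℕ => n + coverClass s j := measurable_from_nat
    exact h1.comp (Nat.measurable_floor.comp measurable_fst)
  · obtain ⟨n, x, z, hd, rfl⟩ := (coverModel hs).surj y
    have h1 := hb n x z hd
    have h2 : ξ (coverPt hs n x z) = 0 := hy
    rw [h2, zero_sub, abs_neg] at h1
    exact ⟨n, ⟨(x, z), (dom_true s).1 hd⟩, h1, (coverPt_of_mem hs n ((dom_true s).1 hd)).symm⟩

/-- Any two coordinates differ by a bounded function. -/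
lemma coordinate_bounded {s : ℕ} (hs : 2 ≤ s) {ξ₀ ξ : Cover s → ℤ} (h₀ : IsCoordinate ξ₀)
    (hb : ∀ n x y, (x, y) ∈ Dom s True → |ξ₀ (coverPt hs n x y) - n| ≤ 1) (h : IsCoordinate ξ) :
    ∃ M : ℤ, ∀ y, |ξ y - ξ₀ y| ≤ M := by
  obtain ⟨N, hN⟩ := h.bounded
  refine ⟨N + 1, fun y => ?_⟩
  -- The translate of `y` by `-ξ y` lies in the bounded fundamental domain, so its `ξ₀`, which is
  -- `ξ₀ y - ξ y`, is at most `N + 1` in absolute value.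
  obtain ⟨n, a, hn, ha⟩ := hN (deck s (-ξ y) y) (by rw [h.deck]; ring)
  have h1 := hb n a.1.1 a.1.2 ((dom_true s).2 a.2)
  rw [coverPt_of_mem hs n a.2] at h1
  change |ξ₀ (Cover.mk n a) - n| ≤ 1 at h1
  rw [ha, h₀.deck] at h1
  rw [abs_le] at *
  constructor <;> linarith [hn.1, hn.2, h1.1, h1.2]

/-- A homogeneous lift that commutes with a lift of an involution reversing the cover class has
zero average drift. -/
theorem hasZeroAverageDrift_of_comm {s : ℕ} (hs : 2 ≤ s) {Ψ J : Cover s ≃ₜ Cover s}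
    {ψ ι : Surface s ≃ₜ Surface s} {ξ₀ : Cover s → ℤ} (h₀ : IsCoordinate ξ₀)
    (hb : ∀ n x y, (x, y) ∈ Dom s True → |ξ₀ (coverPt hs n x y) - n| ≤ 1)
    (hΨ : IsLift Ψ ψ) (hhom : IsHomogeneous Ψ) (hΨm : Measurable Ψ) (hψm : Measurable ψ)
    (hψ : PreservesIntegrals ψ) (hdisp : ∃ C : ℤ, ∀ y, |ξ₀ (Ψ y) - ξ₀ y| ≤ C)
    (hJ : IsLift J ι) (hJd : ∀ m y, J (deck s m y) = deck s (-m) (J y)) (hJm : Measurable J)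
    (hιm : Measurable ι) (hι : PreservesIntegrals ι)
    (hJdisp : ∃ C : ℤ, ∀ y, |ξ₀ (J y) + ξ₀ y| ≤ C) (hcomm : ∀ y, J (Ψ y) = Ψ (J y)) :
    HasZeroAverageDrift Ψ := by
  refine ⟨⟨ξ₀, h₀⟩, fun ξ hξ => ?_⟩
  obtain ⟨M, hM⟩ := coordinate_bounded hs h₀ hb hξ
  obtain ⟨C, hC⟩ := hdisp
  obtain ⟨C', hC'⟩ := hJdisp
  have hfin := lebesgue_finite s hs
  have hfd : ∀ m y, ξ (Ψ (deck s m y)) - ξ (deck s m y) = ξ (Ψ y) - ξ y := fun m y => by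
    rw [hhom, hξ.deck, hξ.deck]; ring
  have hgd : ∀ m y, ξ (deck s m y) + ξ (J (deck s m y)) = ξ y + ξ (J y) := fun m y => by
    rw [hJd, hξ.deck, hξ.deck]; ring
  set F := descend fun y => ξ (Ψ y) - ξ y with hF
  -- The sum descends because `J` reverses the deck action: the two increments `m` and `-m` cancel.
  set H := descend fun y => ξ y + ξ (J y) with hH
  have hFp : ∀ y, F (proj s y) = ξ (Ψ y) - ξ y := descend_proj hs hfd
  have hHp : ∀ y, H (proj s y) = ξ y + ξ (J y) := descend_proj hs hgd
  have hFm : Measurable F := measurable_descend hs ((hξ.measurable.comp hΨm).sub hξ.measurable) hfd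
  have hHm : Measurable H := measurable_descend hs (hξ.measurable.add (hξ.measurable.comp hJm)) hgd
  have hFb : ∀ p, |(F p : ℝ)| ≤ ((C + 2 * M : ℤ) : ℝ) := descend_bounded hs hfd fun y => by
    have h1 := abs_le.1 (hM y)
    have h2 := abs_le.1 (hM (Ψ y))
    have h3 := abs_le.1 (hC y)
    exact abs_le.2 ⟨by linarith [h1.2, h2.1, h3.1], by linarith [h1.1, h2.2, h3.2]⟩
  have hHb : ∀ p, |(H p : ℝ)| ≤ ((C' + 2 * M : ℤ) : ℝ) := descend_bounded hs hgd fun y => by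
    have h1 := abs_le.1 (hM y)
    have h2 := abs_le.1 (hM (J y))
    have h3 := abs_le.1 (hC' y)
    exact abs_le.2 ⟨by linarith [h1.1, h2.1, h3.1], by linarith [h1.2, h2.2, h3.2]⟩
  have hFr : Measurable fun p => (F p : ℝ) := measurable_from_top.comp hFm
  have hHr : Measurable fun p => (H p : ℝ) := measurable_from_top.comp hHm
  -- A map with an invertible lift preserves the complement of the image of the projection, so at
  -- the points outside that image all terms of the identity below vanish.
  have hne : ∀ {P : Cover s ≃ₜ Cover s} {f : Surface s ≃ₜ Surface s}, IsLift P f →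
      ∀ {p}, (∀ y, proj s y ≠ p) → ∀ y, proj s y ≠ f p := by
    intro P f hP p hp y hy
    obtain ⟨y, rfl⟩ := P.surjective y
    rw [hP] at hy
    exact hp y (f.injective hy)
  have key : ∀ p, (F p : ℝ) + F (ι p) = H (ψ p) - H p := by
    intro p
    by_cases hp : ∃ y, proj s y = p
    · obtain ⟨y, rfl⟩ := hp
      rw [← hJ, ← hΨ, hFp, hFp, hHp, hHp, ← hcomm]
      push_cast
      ring
    · have hp : ∀ y, proj s y ≠ p := by simpa using hp
      rw [hF, hH, descend_of_forall_ne _ hp, descend_of_forall_ne _ hp,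
        descend_of_forall_ne _ (hne hJ hp), descend_of_forall_ne _ (hne hΨ hp)]
      simp
  have i1 : Integrable (fun p => (F p : ℝ)) (lebesgue s) := integrable_of_bounded hFr hFb
  have i2 : Integrable (fun p => (F (ι p) : ℝ)) (lebesgue s) :=
    integrable_of_bounded (hFr.comp hιm) fun p => hFb _
  have i3 : Integrable (fun p => (H p : ℝ)) (lebesgue s) := integrable_of_bounded hHr hHb
  have i4 : Integrable (fun p => (H (ψ p) : ℝ)) (lebesgue s) :=
    integrable_of_bounded (hHr.comp hψm) fun p => hHb _
  refine ⟨F, hFp, i1, ?_⟩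
  -- The coboundary integrates to zero by invariance under `ψ`, and `F ∘ ι` has the integral of `F`
  -- by invariance under `ι`; so twice the drift is zero.
  have e1 := integral_add i1 i2
  simp_rw [key] at e1
  rw [integral_sub i4 i3, hψ _ hHr ⟨_, hHb⟩, hι _ hFr ⟨_, hFb⟩] at e1
  linarith

/-! ### Action on the cover class -/

/-- Applying `Ψ` to a lifted path lifts the image path, and commutation with the deck group keeps
the displacement of its end point. -/
lemma preservesCoverClass_of_lift {s : ℕ} {Ψ : Cover s ≃ₜ Cover s} {ψ : Surface s ≃ₜ Surface s}
    (hΨ : IsLift Ψ ψ) (hhom : IsHomogeneous Ψ) : PreservesCoverClass ψ := by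
  rintro γ n ⟨γ', h1, h2⟩
  refine ⟨(Ψ : C(Cover s, Cover s)).comp γ', fun t => ?_, ?_⟩
  · exact (hΨ _).trans (congrArg ψ (h1 t))
  · exact (congrArg Ψ h2).trans (hhom _ _)

lemma reversesCoverClass_of_lift {s : ℕ} {J : Cover s ≃ₜ Cover s} {ι : Surface s ≃ₜ Surface s}
    (hJ : IsLift J ι) (hJd : ∀ m y, J (deck s m y) = deck s (-m) (J y)) :
    ReversesCoverClass ι := by
  rintro γ n ⟨γ', h1, h2⟩
  refine ⟨(J : C(Cover s, Cover s)).comp γ', fun t => ?_, ?_⟩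
  · exact (hJ _).trans (congrArg ι (h1 t))
  · exact (congrArg J h2).trans (hJd _ _)

/-! ### Displacement of the labels -/

/-- A point and its image lie in the same copy `n`, and `ξ₀` differs from `n` by at most 1 at each
of them. -/
lemma displacement_horizontal {s : ℕ} (hs : 2 ≤ s) {ξ₀ : Cover s → ℤ}
    (hb : ∀ n x y, (x, y) ∈ Dom s True → |ξ₀ ((coverModel hs).q n x y) - n| ≤ 1) {T : Cover s → Cover s}
    (hT : ∀ n x y, y ∈ Set.Icc (0 : ℝ) 1 → Free True x y →
      T ((coverModel hs).hline n x y) = (coverModel hs).hline n (x + s * y) y) (y : Cover s) :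
    |ξ₀ (T y) - ξ₀ y| ≤ 2 := by
  have hb' : ∀ n x y, y ∈ Set.Icc (0 : ℝ) 1 → Free True x y →
      |ξ₀ ((coverModel hs).hline n x y) - n| ≤ 1 := fun n x y hy h =>
    hb n _ _ (sub_floor_mem_dom hs hy h)
  obtain ⟨n, x, z, hd, rfl⟩ := (coverModel hs).surj y
  rw [← (coverModel hs).hline_of_mem hs n hd, hT n x z hd.2.1 hd.2.2]
  have h1 := abs_le.1 (hb' n x z hd.2.1 hd.2.2)
  have h2 := abs_le.1 (hb' n (x + s * z) z hd.2.1 (by simpa using hd.2.2.horizontal_shear s))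
  exact abs_le.2 ⟨by linarith [h1.2, h2.1], by linarith [h1.1, h2.2]⟩

lemma displacement_vertical {s : ℕ} (hs : 2 ≤ s) {ξ₀ : Cover s → ℤ}
    (hb : ∀ n x y, (x, y) ∈ Dom s True → |ξ₀ ((coverModel hs).q n x y) - n| ≤ 1) {T : Cover s → Cover s}
    (hT : ∀ n, ∀ k < s, ∀ t ∈ Set.Icc (0 : ℝ) 1, ∀ y, Free True t y →
        T ((coverModel hs).vline n k t y) = (coverModel hs).vline n k t (y + 2 * t))
    (y : Cover s) : |ξ₀ (T y) - ξ₀ y| ≤ 4 := by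
  -- A vertical line, however long, visits only the copies `n` and `n + c k`, whence the bound `1 +
  -- 1`, and 4 for the difference of two values.
  have hb' : ∀ n, ∀ k < s, ∀ t ∈ Set.Icc (0 : ℝ) 1, ∀ y, Free True t y →
      |ξ₀ ((coverModel hs).vline n k t y) - n| ≤ 2 := by
    intro n k hk t ht y h
    have hc : |coverClass s k| ≤ 1 := by
      unfold coverClass
      split_ifs <;> simp
    obtain ⟨l, hl, y', hy', h', j, ⟨rfl, h1, rfl⟩ | ⟨rfl, h1, rfl⟩⟩ :=
      (coverModel hs).vline_eq n hk h
    · rw [h1]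
      exact (hb n _ _ (column_mem_dom hl ht hy' h')).trans (by norm_num)
    · rw [h1]
      have h2 := abs_le.1 (hb (n + coverClass s k) _ _ (column_mem_dom hl ht hy' h'))
      have h3 := abs_le.1 hc
      exact abs_le.2 ⟨by linarith [h2.1, h3.1], by linarith [h2.2, h3.2]⟩
  revert y
  refine (coverModel hs).column_induction hs fun n k hk t ht y hy h => ?_
  rw [← (coverModel hs).vline_of_mem n hk ht hy h, hT n k hk t ht y h]
  have h1 := abs_le.1 (hb' n k hk t ht y h)
  have h2 := abs_le.1 (hb' n k hk t ht (y + 2 * t) (by simpa using h.vertical_shear 2))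
  exact abs_le.2 ⟨by linarith [h1.2, h2.1], by linarith [h1.1, h2.2]⟩

lemma displacement_reflection {s : ℕ} (hs : 2 ≤ s) {ξ₀ : Cover s → ℤ}
    (hb : ∀ n x y, (x, y) ∈ Dom s True → |ξ₀ ((coverModel hs).q n x y) - n| ≤ 1) {T : Cover s → Cover s}
    (hT : ∀ n x y, (x, y) ∈ Dom s True →
      T ((coverModel hs).q n x y) = (coverModel hs).q (-n) (s - x) (1 - y)) (y : Cover s) :
    |ξ₀ (T y) + ξ₀ y| ≤ 2 := by
  obtain ⟨n, x, z, hd, rfl⟩ := (coverModel hs).surj y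
  rw [hT n x z hd]
  have hd' : ((s : ℝ) - x, 1 - z) ∈ Dom s True :=
    ⟨⟨by linarith [hd.1.2], by linarith [hd.1.1]⟩,
      ⟨by linarith [hd.2.1.2], by linarith [hd.2.1.1]⟩, by simpa using hd.2.2.int_sub s 1⟩
  have h1 := abs_le.1 (hb n x z hd)
  have h2 := abs_le.1 (hb (-n) _ _ hd')
  exact abs_le.2 ⟨by linarith [h1.1, h2.1], by linarith [h1.2, h2.2]⟩

lemma torusMap_mul (A B : Matrix (Fin 2) (Fin 2) ℤ) (u : Torus) :
    torusMap (A * B) u = torusMap A (torusMap B u) := by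
  simp only [torusMap, Matrix.mul_apply, Fin.sum_univ_two, smul_add, add_smul, mul_smul]
  congr 1 <;> abel

end Staircase

end

/-! ### Proof of the theorem -/

open Staircase in
theorem mainTheorem8 (s : ℕ) (hs : 2 ≤ s) :
    ∃ (ψ τh τv ι : Surface s ≃ₜ Surface s) (Ψ Th Tv J : Cover s ≃ₜ Cover s),
      -- a homogeneous linear pseudo-Anosov automorphism with zero average drift
      (IsHomogeneousLinearPseudoAnosov Ψ ψ ∧ HasZeroAverageDrift Ψ) ∧
      -- it is a product of a horizontal and a vertical Dehn twist
      ((∀ x, ψ x = τh (τv x)) ∧ (∀ y, Ψ y = Th (Tv y))) ∧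
      (IsHorizontalDehnTwist τh s ∧ IsLift Th τh ∧ PreservesCoverClass τh ∧
        IsHomogeneous Th ∧ HasZeroAverageDrift Th) ∧
      (IsVerticalDehnTwist τv 2 ∧ IsLift Tv τv ∧ PreservesCoverClass τv ∧
        IsHomogeneous Tv ∧ HasZeroAverageDrift Tv) ∧
      -- an involution that reverses the cover class and commutes with the twists
      (IsLinearAutomorphism ι (-1) ∧ (∀ x, ι (ι x) = x) ∧ ReversesCoverClass ι ∧
        (∀ x, ι (τh x) = τh (ι x)) ∧ (∀ x, ι (τv x) = τv (ι x))) ∧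
      (IsLift J ι ∧ (∀ y, J (J y) = y) ∧ (∀ m y, J (deck s m y) = deck s (-m) (J y)) ∧
        (∀ y, J (Th y) = Th (J y)) ∧ (∀ y, J (Tv y) = Tv (J y))) := by
  have hc := coverClass_perm hs
  have hc' := coverClass_reflect hs
  obtain ⟨τh, mτh, hτh⟩ := (surfaceModel s).exists_horizontal_homeomorph hs
  obtain ⟨τv, mτv, hτv⟩ := (surfaceModel s).exists_vertical_homeomorph hs (by simp)
  obtain ⟨ι, mι, hιι, hι⟩ := (surfaceModel s).exists_reflection_homeomorph hs (by simp)
  obtain ⟨Th, mTh, hTh⟩ := (coverModel hs).exists_horizontal_homeomorph hs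
  obtain ⟨Tv, mTv, hTv⟩ := (coverModel hs).exists_vertical_homeomorph hs hc
  obtain ⟨J, mJ, hJJ, hJ⟩ := (coverModel hs).exists_reflection_homeomorph hs hc'
  obtain ⟨ξ₀, h₀, hb⟩ := exists_coordinate hs
  have hproj : ∀ n x y, (x, y) ∈ Dom s True →
      proj s ((coverModel hs).q n x y) = (surfaceModel s).q () x y := proj_coverPt hs
  have hdeck : ∀ m n x y, (x, y) ∈ Dom s True →
      deck s m ((coverModel hs).q n x y) = (coverModel hs).q (n + m) x y := deck_coverPt hs
  have lh : IsLift Th τh :=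
    (coverModel hs).horizontal_comm (surfaceModel s) hs (by simp) hproj hTh hτh
  have lv : IsLift Tv τv :=
    (coverModel hs).vertical_comm (surfaceModel s) hs (by simp) (by simp) hproj hTv hτv
  have hd' : ∀ x y, (x, y) ∈ Dom s True → ((s : ℝ) - x, 1 - y) ∈ Dom s True := fun x z hd =>
    ⟨⟨by linarith [hd.1.2], by linarith [hd.1.1]⟩,
      ⟨by linarith [hd.2.1.2], by linarith [hd.2.1.1]⟩, by simpa using hd.2.2.int_sub s 1⟩
  have lJ : IsLift J ι := by
    intro y
    obtain ⟨n, x, z, hd, rfl⟩ := (coverModel hs).surj y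
    rw [hJ n x z hd, hproj _ _ _ (hd' _ _ hd), hproj _ _ _ hd,
      hι () x z ⟨hd.1, hd.2.1, free_false _ _⟩]
  have homh : IsHomogeneous Th := fun m y =>
    ((coverModel hs).horizontal_comm (coverModel hs) hs (by simp) (hdeck m) hTh hTh y).symm
  have homv : IsHomogeneous Tv := fun m y =>
    ((coverModel hs).vertical_comm (coverModel hs) hs (by simp)
      (fun n k => by ring) (hdeck m) hTv hTv y).symm
  have hJd : ∀ m y, J (deck s m y) = deck s (-m) (J y) := by
    intro m y
    obtain ⟨n, x, z, hd, rfl⟩ := (coverModel hs).surj y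
    rw [hdeck _ _ _ _ hd, hJ _ x z hd, hJ _ x z hd, hdeck _ _ _ _ (hd' _ _ hd), neg_add]
  have cιh := (surfaceModel s).reflection_horizontal_comm hs hτh hι
  have cιv := (surfaceModel s).reflection_vertical_comm hs (by simp) (by simp) hτv hι
  have cJh := (coverModel hs).reflection_horizontal_comm hs hTh hJ
  have cJv := (coverModel hs).reflection_vertical_comm hs hc hc' hTv hJ
  have dh := displacement_horizontal hs hb hTh
  have dv := displacement_vertical hs hb hTv
  have dJ := displacement_reflection hs hb hJ
  have ph := preservesIntegrals_horizontal hs mτh hτh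
  have pv := preservesIntegrals_vertical mτv hτv
  have pι := preservesIntegrals_reflection mι hι
  have devh := dev_horizontal hs hτh
  have devv := dev_vertical hs hτv
  have eA : (!![1, (s : ℤ); 0, 1] : Matrix (Fin 2) (Fin 2) ℤ).map ((↑) : ℤ → ℝ) =
      !![1, (s : ℝ); 0, 1] := by
    ext i j; fin_cases i <;> fin_cases j <;> simp
  have eB : (!![1, 0; 2, 1] : Matrix (Fin 2) (Fin 2) ℤ).map ((↑) : ℤ → ℝ) = !![1, 0; 2, 1] := by
    ext i j; fin_cases i <;> fin_cases j <;> simp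
  have eI : (-1 : Matrix (Fin 2) (Fin 2) ℤ).map ((↑) : ℤ → ℝ) = -1 := by
    ext i j; fin_cases i <;> fin_cases j <;> simp
  -- The derivative of the composition, horizontal factor on the left because the vertical twist is
  -- applied first.
  have eC : (!![1, (s : ℤ); 0, 1] * !![1, 0; 2, 1] : Matrix (Fin 2) (Fin 2) ℤ).map
      ((↑) : ℤ → ℝ) = !![1 + (s : ℝ) * 2, (s : ℝ); 2, 1] := by
    ext i j; fin_cases i <;> fin_cases j <;> simp
  have fh : ∀ x y, (x, y) ∈ Dom s False → IsVertex (x, y) →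
      τh (surfacePt s x y) = surfacePt s x y := fun x y hd hv => horizontal_fix hs hτh hd hv.2
  have fv : ∀ x y, (x, y) ∈ Dom s False → IsVertex (x, y) →
      τv (surfacePt s x y) = surfacePt s x y := fun x y hd hv => vertical_fix hs hτv hd hv.1
  set ψ := τv.trans τh with hψ
  set Ψ := Tv.trans Th with hΨ
  have lΨ : IsLift Ψ ψ := fun y => (lh _).trans (congrArg τh (lv y))
  have homΨ : IsHomogeneous Ψ := fun m y => (congrArg Th (homv m y)).trans (homh m _)
  have devψ : ∀ p, dev s (ψ p) = torusMap (!![1, (s : ℤ); 0, 1] * !![1, 0; 2, 1]) (dev s p) :=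
    fun p => by
      rw [torusMap_mul, ← devv, ← devh]
      rfl
  have hdet : (!![1 + (s : ℝ) * 2, (s : ℝ); 2, 1] : Matrix (Fin 2) (Fin 2) ℝ).det = 1 := by
    rw [Matrix.det_fin_two_of]; ring
  have htr : 2 < |(!![1 + (s : ℝ) * 2, (s : ℝ); 2, 1] : Matrix (Fin 2) (Fin 2) ℝ).trace| := by
    have : (2 : ℝ) ≤ s := by exact_mod_cast hs
    rw [Matrix.trace_fin_two_of]
    exact lt_of_lt_of_le (by linarith) (le_abs_self _)
  have linh : IsLinearAutomorphism τh !![1, (s : ℝ); 0, 1] :=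
    ⟨image_marked_of_fix fh, eA ▸ hasLinearPart_of_torusMap _ devh⟩
  have linv : IsLinearAutomorphism τv !![1, 0; 2, 1] :=
    ⟨image_marked_of_fix fv, eB ▸ hasLinearPart_of_torusMap _ devv⟩
  have linψ : IsLinearAutomorphism ψ !![1 + (s : ℝ) * 2, (s : ℝ); 2, 1] :=
    ⟨image_marked_of_fix fun x y hd hv => (congrArg τh (fv x y hd hv)).trans (fh x y hd hv),
      eC ▸ hasLinearPart_of_torusMap _ devψ⟩
  have linι : IsLinearAutomorphism ι (-1) :=
    ⟨image_marked_of_reflection hιι hι, eI ▸ hasLinearPart_of_torusMap _ (dev_reflection hι)⟩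
  have zh : HasZeroAverageDrift Th := hasZeroAverageDrift_of_comm hs h₀ hb lh homh mTh mτh ph
    ⟨2, dh⟩ lJ hJd mJ mι pι ⟨2, dJ⟩ cJh
  have zv : HasZeroAverageDrift Tv := hasZeroAverageDrift_of_comm hs h₀ hb lv homv mTv mτv pv
    ⟨4, dv⟩ lJ hJd mJ mι pι ⟨2, dJ⟩ cJv
  have zΨ : HasZeroAverageDrift Ψ := by
    -- The symmetry argument is applied to the product itself; 6 is the sum of the displacement
    -- bounds 2 and 4 of the two factors.
    refine hasZeroAverageDrift_of_comm hs h₀ hb lΨ homΨ (mTh.comp mTv) (mτh.comp mτv)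
      (ph.comp pv mτh) ⟨6, fun y => ?_⟩ lJ hJd mJ mι pι ⟨2, dJ⟩
      (fun y => (cJh (Tv y)).trans (congrArg Th (cJv y)))
    have h1 := abs_le.1 (dh (Tv y))
    have h2 := abs_le.1 (dv y)
    exact abs_le.2 ⟨by simp only [hΨ, Homeomorph.trans_apply]; linarith [h1.1, h2.1],
      by simp only [hΨ, Homeomorph.trans_apply]; linarith [h1.2, h2.2]⟩
  refine ⟨ψ, τh, τv, ι, Ψ, Th, Tv, J, ⟨⟨⟨_, linψ, hdet, htr⟩, lΨ, homΨ, _,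
    eC ▸ hasLinearPart_cover lΨ devψ _, hdet, htr⟩, zΨ⟩, ⟨fun _ => rfl, fun _ => rfl⟩,
    ⟨⟨?_, linh, fun a ha => ?_⟩, lh, preservesCoverClass_of_lift lh homh, homh, zh⟩,
    ⟨⟨by norm_num, linv, fun a ha => ?_⟩, lv, preservesCoverClass_of_lift lv homv, homv, zv⟩,
    ⟨linι, hιι, reversesCoverClass_of_lift lJ hJd, cιh, cιv⟩, lJ, hJJ, hJd, cJh, cJv⟩
  · have : (2 : ℝ) ≤ s := by exact_mod_cast hs
    linarith
  · have := horizontal_fix hs hτh ((dom_false s).2 a.2) (Or.inl ha)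
    rwa [surfacePt_of_mem a.2] at this
  · have := vertical_fix hs hτv ((dom_false s).2 a.2) ha
    rwa [surfacePt_of_mem a.2] at this
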